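/- Let $[n]=\{1,\dots,n\}$. For labeled points $p_1,\dots,p_n$ in the plane in general position (distinct, no three collinear), the chirotope assigns to each triple $(i,j,k)\in[n]^3$ the orientation of $(p_i,p_j,p_k)$: $+1$ for counterclockwise, $-1$ for clockwise, and $0$ if $i,j,k$ are not pairwise distinct. More generally, a generalized configuration consists of $n$ labeled distinct points and an arrangement of pseudo-lines (graphs of continuous functions $\mathbb R\to\mathbb R$, any two of which meet in exactly one point and cross there) such that each pseudo-line contains exactly two of the points and each pair of points lies on a pseudo-line; its chirotope $\chi$ has $\chi(i,j,k)=+1$ or $-1$, for pairwise distinct $i,j,k$, according to whether $p_k$ lies to the left or to the right of the pseudo-line through $p_i,p_j$ directed from $p_i$ to $p_j$, and $\chi(i,j,k)=0$ otherwise. Identifying a chirotope with its negative, the classes of chirotopes of point sets are called order types and those of generalized configurations abstract order types. The (counterclockwise) radial system of a chirotope assigns to each $i\in[n]$ the cyclic permutation $R(i)$ of $[n]\setminus\{i\}$ in which the other points appear counterclockwise around $p_i$. Let $T(R)$ be the set of abstract order types that are represented by a chirotope with radial system $R$. An algorithm may access $R$ only through queries. A query is a triple test (in which cyclic order do $j,k,l$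 appear in $R(i)$?), a request for the index of $j$ in $R(i)$ read from a given element $s$ on, or a request for the element at a given position of $R(i)$ read from a given element $s$ on; queries may depend on the previous answers, and the computation between queries is unrestricted and free. Then determining $|T(R)|$ needs $\Omega(n)$ queries in the worst case: there are constants $c>0$ and $N$ such that for every $n\ge N$ and every deterministic algorithm that correctly outputs $|T(R)|$ for each radial system $R$ on $[n]$ of an order type (of a point set in general position), there is such a radial system $R$ on which the algorithm makes at least $c\,n$ queries. -/

import Mathlib

namespace RadialSystems

/-! ### Chirotopes and order types -/

/-- Orientation functions on triples of labels: `1` is counterclockwise, `-1` is clockwise. -/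
abbrev Chirotope (n : ℕ) : Type := Fin n → Fin n → Fin n → SignType

/-- Pairwise distinctness of three labels. -/
def Distinct3 {n : ℕ} (i j k : Fin n) : Prop := i ≠ j ∧ i ≠ k ∧ j ≠ k

/-- The chirotope of a labeled family of points in the plane: the sign of the determinant of
`(p j - p i, p k - p i)`. -/
noncomputable def pointChirotope {n : ℕ} (p : Fin n → ℝ × ℝ) : Chirotope n := fun i j k =>
  SignType.sign (((p j).1 - (p i).1) * ((p k).2 - (p i).2)
    - ((p j).2 - (p i).2) * ((p k).1 - (p i).1))

/-- Labeled point sets in general position: distinct points, no three of them collinear. -/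
def GeneralPosition {n : ℕ} (p : Fin n → ℝ × ℝ) : Prop :=
  Function.Injective p ∧ ∀ i j k, Distinct3 i j k → pointChirotope p i j k ≠ 0

/-- The graphs of `f` and `g` have exactly one common point, and they cross there. -/
def CrossOnce (f g : ℝ → ℝ) : Prop :=
  ∃ x, f x = g x ∧
    (((∀ y, y < x → f y < g y) ∧ (∀ y, x < y → g y < f y)) ∨
     ((∀ y, y < x → g y < f y) ∧ (∀ y, x < y → f y < g y)))

/-- The point `q` lies on the graph of `f`. -/
def OnCurve (q : ℝ × ℝ) (f : ℝ → ℝ) : Prop := f q.1 = q.2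

/-- A generalized configuration of `n` labeled points: distinct points together with an
arrangement of pseudo-lines (`x`-monotone curves, i.e. graphs of continuous functions `ℝ → ℝ`,
every two of which meet in exactly one point and cross there) such that each pseudo-line contains
exactly two of the points and each pair of points lies on a pseudo-line. -/
structure GeneralizedConfiguration (n : ℕ) where
  pt : Fin n → ℝ × ℝ
  lines : Set (ℝ → ℝ)
  pt_injective : Function.Injective pt
  continuous_of_mem : ∀ f ∈ lines, Continuous f
  crossOnce : ∀ f ∈ lines, ∀ g ∈ lines, f ≠ g → CrossOnce f g
  two_points : ∀ f ∈ lines, {i | OnCurve (pt i) f}.ncard = 2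
  exists_line : ∀ i j, i ≠ j → ∃ f ∈ lines, OnCurve (pt i) f ∧ OnCurve (pt j) f

/-- `χ` is the chirotope of the generalized configuration `C`. If the pseudo-line `f` through
`p i` and `p j` is directed from `p i` to `p j`, its left side is the side above `f` if `p i` is to
the left of `p j` in the plane, and the side below `f` otherwise. -/
def IsChirotopeOf {n : ℕ} (C : GeneralizedConfiguration n) (χ : Chirotope n) : Prop :=
  (∀ i j k, ¬ Distinct3 i j k → χ i j k = 0) ∧
  ∀ i j k, Distinct3 i j k → ∀ f ∈ C.lines, OnCurve (C.pt i) f → OnCurve (C.pt j) f →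
    χ i j k = SignType.sign ((C.pt j).1 - (C.pt i).1)
      * SignType.sign ((C.pt k).2 - f (C.pt k).1)

/-- Chirotopes of generalized configurations. -/
def IsAbstractChirotope {n : ℕ} (χ : Chirotope n) : Prop :=
  ∃ C : GeneralizedConfiguration n, IsChirotopeOf C χ

/-- Two chirotopes are equivalent if they are equal or negatives of each other. -/
def chirotopeSetoid (n : ℕ) : Setoid (Chirotope n) where
  r χ χ' := (∀ i j k, χ i j k = χ' i j k) ∨ (∀ i j k, χ i j k = -χ' i j k)
  iseqv :=
    { refl := fun _ => Or.inl fun _ _ _ => rfl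
      symm := by
        rintro χ χ' (h | h)
        · exact Or.inl fun i j k => (h i j k).symm
        · exact Or.inr fun i j k => by rw [h, neg_neg]
      trans := by
        rintro χ χ' χ'' (h | h) (h' | h')
        · exact Or.inl fun i j k => by rw [h, h']
        · exact Or.inr fun i j k => by rw [h, h']
        · exact Or.inr fun i j k => by rw [h, h']
        · exact Or.inl fun i j k => by rw [h, h', neg_neg] }

/-- Equivalence classes of orientation functions; (abstract) order types are the classes of
(abstract) chirotopes. -/
abbrev OrderType (n : ℕ) : Type := Quotient (chirotopeSetoid n)

/-! ### Radial systems -/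

/-- A system of permutations: `R i j` is the element that follows `j` in the rotation around `i`.
That `R i` is a cyclic permutation of the labels other than `i` is part of `IsRadialSystemOf`. -/
abbrev RotationSystem (n : ℕ) : Type := Fin n → Equiv.Perm (Fin n)

/-- The points `j, k, l` appear in this counterclockwise cyclic order around `i`: at most one of
the counterclockwise angles from `j` to `k`, from `k` to `l` and from `l` to `j`, seen from `i`,
exceeds a half-turn, so at least two of the triples `(i,j,k)`, `(i,k,l)`, `(i,l,j)` are oriented
counterclockwise. -/
def CcwAround {n : ℕ} (χ : Chirotope n) (i j k l : Fin n) : Prop :=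
  (χ i j k = 1 ∧ χ i k l = 1) ∨ (χ i k l = 1 ∧ χ i l j = 1) ∨ (χ i l j = 1 ∧ χ i j k = 1)

/-- The index of `j` in the linear order obtained from the cyclic permutation `σ` by starting
at `s`. -/
noncomputable def index {n : ℕ} (σ : Equiv.Perm (Fin n)) (s j : Fin n) : ℕ :=
  sInf {r : ℕ | (σ ^ r) s = j}

/-- `R` is the (counterclockwise) radial system of `χ`: for each `i`, `R i` is a cyclic permutation
of the labels other than `i`, and it lists them in counterclockwise order around `i`. -/
def IsRadialSystemOf {n : ℕ} (χ : Chirotope n) (R : RotationSystem n) : Prop :=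
  ∀ i, (R i).IsCycleOn {j | j ≠ i} ∧
    ∀ j k l, j ≠ i → k ≠ i → l ≠ i → Distinct3 j k l →
      (CcwAround χ i j k l ↔ index (R i) j k < index (R i) j l)

/-- `T(R)`: the set of abstract order types with radial system `R`. -/
def T {n : ℕ} (R : RotationSystem n) : Set (OrderType n) :=
  {τ | ∃ χ, IsAbstractChirotope χ ∧ IsRadialSystemOf χ R ∧ Quotient.mk (chirotopeSetoid n) χ = τ}

/-- `R` is the radial system of the order type of a labeled point set in general position. -/
def IsOrderTypeRadialSystem {n : ℕ} (R : RotationSystem n) : Prop :=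
  ∃ p : Fin n → ℝ × ℝ, GeneralPosition p ∧ IsRadialSystemOf (pointChirotope p) R

/-! ### Query algorithms -/

/-- The queries to a radial system: triple tests (in which cyclic order do `j, k, l` appear around
`i`?), queries for the index of `j` in the rotation around `i` read from `s` on, and queries for the
element at position `r` of the rotation around `i` read from `s` on. -/
inductive Query (n : ℕ) : Type
  | tripleTest (i j k l : Fin n) : Query n
  | indexOf (i s j : Fin n) : Query n
  | entryAt (i s : Fin n) (r : ℕ) : Query n

/-- The type of answers to a query. -/
def Query.Answer {n : ℕ} : Query n → Type
  | .tripleTest _ _ _ _ => Bool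
  | .indexOf _ _ _ => ℕ
  | .entryAt _ _ _ => Fin n

/-- The answer to a query on the system `R`. -/
noncomputable def Query.answer {n : ℕ} (R : RotationSystem n) : (q : Query n) → q.Answer
  | .tripleTest i j k l => decide (index (R i) j k < index (R i) j l)
  | .indexOf i s j => index (R i) s j
  | .entryAt i s r => (R i ^ r) s

/-- Deterministic query algorithms for inputs with `n` labels, as decision trees: an algorithm
either stops with an output or asks a query, chosen in terms of all previous answers, and continues
in a way that depends on the answer. No restriction is put on the computation between queries. -/
inductive Algorithm (n : ℕ) : Type
  | output (m : ℕ) : Algorithm n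
  | ask (q : Query n) (next : q.Answer → Algorithm n) : Algorithm n

/-- The output of an algorithm on the system `R`. -/
noncomputable def Algorithm.run {n : ℕ} (R : RotationSystem n) : Algorithm n → ℕ
  | .output m => m
  | .ask q next => (next (q.answer R)).run R

/-- The number of queries that an algorithm asks on the system `R`. -/
noncomputable def Algorithm.numQueries {n : ℕ} (R : RotationSystem n) : Algorithm n → ℕ
  | .output _ => 0
  | .ask q next => (next (q.answer R)).numQueries R + 1

/-- The algorithm determines `|T(R)|` for each radial system `R` of an order type on `n` labels. -/
def Algorithm.DeterminesCard {n : ℕ} (A : Algorithm n) : Prop :=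
  ∀ R : RotationSystem n, IsOrderTypeRadialSystem R → A.run R = (T R).ncard

end RadialSystems

namespace RadialSystems

open Filter Topology

/-! ### Alternating orientation functions -/

/-! This is an adversary argument. The input is a "ladder": pairs of close twins placed along a
parabola, with label `0` on the left and label `1` on the right. If `0` lies to the left of every
twin line, the line through `0` and `1` can pass below or above all other points without changing
any rotation (`IsLadder.sameRadial`). Both versions are realized by point sets, and they are not
negatives of each other, so `|T(R)| ≥ 2` (`IsLadder.one_lt_ncard`).

Now tilt the twin line of one level `m` so that `0` changes side. Then `0`, `1` and these twins form
a convex quadruple, whose orientations can be read off the radial system (`SameRadial.convex`). This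
fixes the side of the line through `0` and `1` for the twins at `m`, and from there every other
orientation follows. It follows through further convex quadruples, through quadruples with an inner
point whose outer triangle is already oriented (`SameRadial.inner`), and through acyclicity of
abstract chirotopes. Hence `|T(R')| ≤ 1` (`IsLadder.unique`, `IsLadder.ncard_le_one`).

The two ladders differ only on triples containing both twins of level `m` (`IsLadder.agreeOff`). An
index in a rotation counts the points between two others, and each such betweenness test with fixed
points off the pair sees at most one of the twins. So a query that neither names nor returns a twin
of level `m` has the same answer on `R` and `R'` (`Query.answer_eq`). A query involves at most four
levels. An algorithm with fewer than `n / 16` queries therefore misses some level and outputs the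
same number for both inputs.

The geometric input has two directions. Every abstract chirotope is alternating and acyclic, which
bounds `T(R')` from above. Every point set in general position gives an abstract chirotope after a
perturbation removing vertical and parallel connecting lines, which puts both ladders into `T(R)`.
-/

/-- Orientation functions that are alternating and vanish exactly on degenerate triples. -/
structure IsAlternating {n : ℕ} (χ : Chirotope n) : Prop where
  eq_zero : ∀ i j k, ¬ Distinct3 i j k → χ i j k = 0
  ne_zero : ∀ i j k, Distinct3 i j k → χ i j k ≠ 0
  rot : ∀ i j k, χ j k i = χ i j k
  swap : ∀ i j k, χ j i k = -χ i j k

/-- No point lies to the left of all three sides of a clockwise triangle. -/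
def IsAcyclic {n : ℕ} (χ : Chirotope n) : Prop :=
  ∀ a b c d, χ a b d = 1 → χ b c d = 1 → χ c a d = 1 → a ≠ b → a ≠ c → b ≠ c → χ a b c = 1

theorem Distinct3.rot {n : ℕ} {i j k : Fin n} (h : Distinct3 i j k) : Distinct3 j k i :=
  ⟨h.2.2, h.1.symm, h.2.1.symm⟩

theorem Distinct3.swap {n : ℕ} {i j k : Fin n} (h : Distinct3 i j k) : Distinct3 j i k :=
  ⟨h.1.symm, h.2.2, h.2.1⟩

section GeneralizedConfiguration

variable {n : ℕ} (C : GeneralizedConfiguration n)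

theorem GeneralizedConfiguration.not_onCurve {i j k : Fin n} (h : Distinct3 i j k) {f : ℝ → ℝ}
    (hf : f ∈ C.lines) (hi : OnCurve (C.pt i) f) (hj : OnCurve (C.pt j) f) :
    ¬ OnCurve (C.pt k) f := by
  intro hk
  have h2 := C.two_points f hf
  have hsub : (({i, j, k} : Finset (Fin n)) : Set (Fin n)) ⊆ {i | OnCurve (C.pt i) f} := by
    intro x hx
    simp only [Finset.coe_insert, Finset.coe_singleton, Set.mem_insert_iff,
      Set.mem_singleton_iff] at hx
    rcases hx with rfl | rfl | rfl <;> assumption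
  have h3 := Set.ncard_le_ncard hsub (Set.toFinite _)
  rw [Set.ncard_coe_finset, Finset.card_eq_three.2 ⟨i, j, k, h.1, h.2.1, h.2.2, rfl⟩] at h3
  omega

/-- A pseudo-line is a graph, so it cannot carry two distinct points with the same abscissa. -/
theorem GeneralizedConfiguration.fst_ne {i j : Fin n} (h : i ≠ j) :
    (C.pt i).1 ≠ (C.pt j).1 := by
  intro hx
  obtain ⟨f, -, hi, hj⟩ := C.exists_line i j h
  apply h
  apply C.pt_injective
  refine Prod.ext hx ?_
  rw [← hi, ← hj, hx]

/-- Two pseudo-lines through a common point `p i` cross at that point. -/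
theorem GeneralizedConfiguration.cross_at {i : Fin n} {f g : ℝ → ℝ} (hf : f ∈ C.lines)
    (hg : g ∈ C.lines) (hne : f ≠ g) (hif : OnCurve (C.pt i) f) (hig : OnCurve (C.pt i) g) :
    ((∀ y, y < (C.pt i).1 → f y < g y) ∧ (∀ y, (C.pt i).1 < y → g y < f y)) ∨
     ((∀ y, y < (C.pt i).1 → g y < f y) ∧ (∀ y, (C.pt i).1 < y → f y < g y)) := by
  obtain ⟨x, -, h⟩ := C.crossOnce f hf g hg hne
  have hfg : f (C.pt i).1 = g (C.pt i).1 := hif.trans hig.symm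
  have hx : x = (C.pt i).1 := by
    rcases lt_trichotomy x (C.pt i).1 with hx | hx | hx
    · rcases h with h | h
      · have := h.2 _ hx; linarith
      · have := h.2 _ hx; linarith
    · exact hx
    · rcases h with h | h
      · have := h.1 _ hx; linarith
      · have := h.1 _ hx; linarith
  rwa [hx] at h

/-- Sign form of `cross_at`. -/
theorem GeneralizedConfiguration.exists_sign_sub {i : Fin n} {f g : ℝ → ℝ} (hf : f ∈ C.lines)
    (hg : g ∈ C.lines) (hne : f ≠ g) (hif : OnCurve (C.pt i) f) (hig : OnCurve (C.pt i) g) :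
    ∃ e : SignType, ∀ y, SignType.sign (f y - g y) = e * SignType.sign (y - (C.pt i).1) := by
  have hfg : f (C.pt i).1 = g (C.pt i).1 := hif.trans hig.symm
  rcases C.cross_at hf hg hne hif hig with h | h
  · refine ⟨1, fun y => ?_⟩
    rcases lt_trichotomy y (C.pt i).1 with hy | hy | hy
    · rw [sign_neg (sub_neg.2 (h.1 _ hy)), sign_neg (sub_neg.2 hy)]; rfl
    · rw [hy, hfg]; simp
    · rw [sign_pos (sub_pos.2 (h.2 _ hy)), sign_pos (sub_pos.2 hy)]; rfl
  · refine ⟨-1, fun y => ?_⟩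
    rcases lt_trichotomy y (C.pt i).1 with hy | hy | hy
    · rw [sign_pos (sub_pos.2 (h.1 _ hy)), sign_neg (sub_neg.2 hy)]; rfl
    · rw [hy, hfg]; simp
    · rw [sign_neg (sub_neg.2 (h.2 _ hy)), sign_pos (sub_pos.2 hy)]; rfl

theorem sign_sub_comm (x y : ℝ) : SignType.sign (x - y) = -SignType.sign (y - x) := by
  rw [← Left.sign_neg, neg_sub]

theorem IsChirotopeOf.isAlternating {C : GeneralizedConfiguration n} {χ : Chirotope n}
    (h : IsChirotopeOf C χ) :
    IsAlternating χ where
  eq_zero := h.1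
  ne_zero i j k hd := by
    obtain ⟨f, hf, hi, hj⟩ := C.exists_line i j hd.1
    rw [h.2 i j k hd f hf hi hj]
    refine mul_ne_zero ?_ ?_
    · rw [sign_ne_zero, sub_ne_zero]
      exact C.fst_ne hd.1.symm
    · rw [sign_ne_zero, sub_ne_zero]
      exact fun hk => C.not_onCurve hd hf hi hj hk.symm
  rot i j k := by
    by_cases hd : Distinct3 i j k
    · obtain ⟨f, hf, hfi, hfj⟩ := C.exists_line i j hd.1
      obtain ⟨g, hg, hgj, hgk⟩ := C.exists_line j k hd.2.2
      have hne : f ≠ g := fun e => C.not_onCurve hd hf hfi hfj (e ▸ hgk)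
      -- The pseudo-lines through `i, j` and `j, k` swap their vertical order exactly at `j`.
      -- Comparing them at the abscissas of `i` and of `k` relates the side of `k` to the side of
      -- `i`.
      obtain ⟨e, he⟩ := C.exists_sign_sub hf hg hne hfj hgj
      rw [h.2 i j k hd f hf hfi hfj, h.2 j k i hd.rot g hg hgj hgk]
      have h1 := he (C.pt i).1
      have h2 := he (C.pt k).1
      rw [show f (C.pt i).1 = (C.pt i).2 from hfi] at h1
      rw [show g (C.pt k).1 = (C.pt k).2 from hgk, sign_sub_comm] at h2
      rw [h1, neg_eq_iff_eq_neg.1 h2, sign_sub_comm (C.pt i).1]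
      generalize SignType.sign ((C.pt k).1 - (C.pt j).1) = x
      generalize SignType.sign ((C.pt j).1 - (C.pt i).1) = y
      clear h1 h2 he
      revert x y e; decide
    · rw [h.1 i j k hd, h.1 j k i fun h' => hd h'.rot.rot]
  swap i j k := by
    by_cases hd : Distinct3 i j k
    · obtain ⟨f, hf, hfi, hfj⟩ := C.exists_line i j hd.1
      rw [h.2 i j k hd f hf hfi hfj, h.2 j i k hd.swap f hf hfj hfi, sign_sub_comm, neg_mul]
    · rw [h.1 i j k hd, h.1 j i k fun h' => hd h'.swap, neg_zero]

/-- The three sides cross pairwise only at the vertices, so their vertical order over any abscissa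
is known. Being on the left of all three sides of a clockwise triangle would be contradictory over
the abscissa of `d`. -/
theorem IsChirotopeOf.isAcyclic {C : GeneralizedConfiguration n} {χ : Chirotope n}
    (h : IsChirotopeOf C χ) : IsAcyclic χ := by
  intro a b c d h1 h2 h3 hab hac hbc
  have hA := h.isAlternating
  by_contra h4
  have hD : Distinct3 a b c := ⟨hab, hac, hbc⟩
  have h5 : χ a b c = -1 := by
    have := hA.ne_zero a b c hD
    generalize χ a b c = x at *
    revert x; decide
  have dist : ∀ {i j k}, χ i j k = 1 → Distinct3 i j k := by
    intro i j k hh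
    by_contra hh'
    rw [h.1 _ _ _ hh'] at hh
    exact absurd hh (by decide)
  obtain ⟨f, hf, hfa, hfb⟩ := C.exists_line a b hab
  obtain ⟨g, hg, hgb, hgc⟩ := C.exists_line b c hbc
  obtain ⟨l, hl, hlc, hla⟩ := C.exists_line c a hac.symm
  have h6 : χ b c a = -1 := by rw [hA.rot, h5]
  have h7 : χ c a b = -1 := by rw [hA.rot, h6]
  have hgf : g ≠ f := fun e => C.not_onCurve hD hf hfa hfb (e ▸ hgc)
  have hlg : l ≠ g := fun e => C.not_onCurve hD.rot hg hgb hgc (e ▸ hla)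
  have hfl : f ≠ l := fun e => C.not_onCurve hD.rot.rot hl hlc hla (e ▸ hfb)
  rw [h.2 a b d (dist h1) f hf hfa hfb] at h1
  rw [h.2 b c d (dist h2) g hg hgb hgc] at h2
  rw [h.2 c a d (dist h3) l hl hlc hla] at h3
  rw [h.2 a b c hD f hf hfa hfb, ← (show l _ = _ from hlc)] at h5
  rw [h.2 b c a hD.rot g hg hgb hgc, ← (show f _ = _ from hfa)] at h6
  rw [h.2 c a b hD.rot.rot l hl hlc hla, ← (show g _ = _ from hgb)] at h7
  have c1 := C.cross_at hf hl hfl hfa hla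
  have c2 := C.cross_at hg hf hgf hgb hfb
  have c3 := C.cross_at hl hg hlg hlc hgc
  have up : ∀ {x y : ℝ} (s : SignType), x < y → SignType.sign (y - x) * s = s := by
    intro x y s hxy
    rw [sign_pos (sub_pos.2 hxy), one_mul]
  have down : ∀ {x y : ℝ} (s : SignType), y < x → SignType.sign (y - x) * s = -s := by
    intro x y s hxy
    rw [sign_neg (sub_neg.2 hxy), neg_one_mul]
  -- The left-to-right order of `a, b, c` decides for each side whether "left" means above or below;
  -- two of the eight combinations are cyclic and impossible.
  rcases (C.fst_ne hab).lt_or_gt with n1 | n1 <;> rcases (C.fst_ne hac).lt_or_gt with n2 | n2 <;>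
    rcases (C.fst_ne hbc).lt_or_gt with n3 | n3
  all_goals
    first
    | (exfalso; linarith)
    | skip
  all_goals
    first
    | rw [up _ n1] at h1 h5
    | rw [down _ n1, neg_eq_iff_eq_neg] at h1 h5
  all_goals
    first
    | rw [up _ n2] at h3 h7
    | rw [down _ n2, neg_eq_iff_eq_neg] at h3 h7
  all_goals
    first
    | rw [up _ n3] at h2 h6
    | rw [down _ n3, neg_eq_iff_eq_neg] at h2 h6
  all_goals
    simp only [neg_neg, sign_eq_one_iff, sign_eq_neg_one_iff, sub_pos, sub_neg] at h1 h2 h3 h5 h6 h7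
    clear hgf hlg hfl hD hf hg hl dist up down h4 h hA hfa hfb hgb hgc hlc hla
    grind

end GeneralizedConfiguration

/-! ### Point sets -/

/-- Twice the signed area of a triangle. -/
def area (p q r : ℝ × ℝ) : ℝ :=
  (q.1 - p.1) * (r.2 - p.2) - (q.2 - p.2) * (r.1 - p.1)

theorem pointChirotope_eq {n : ℕ} (p : Fin n → ℝ × ℝ) (i j k : Fin n) :
    pointChirotope p i j k = SignType.sign (area (p i) (p j) (p k)) := rfl

theorem area_rot (p q r : ℝ × ℝ) : area q r p = area p q r := by
  simp only [area]; ring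

theorem area_swap (p q r : ℝ × ℝ) : area q p r = -area p q r := by
  simp only [area]; ring

theorem GeneralPosition.isAlternating {n : ℕ} {p : Fin n → ℝ × ℝ} (hp : GeneralPosition p) :
    IsAlternating (pointChirotope p) where
  eq_zero i j k h := by
    rw [pointChirotope_eq, sign_eq_zero_iff, area]
    simp only [Distinct3, not_and_or, not_not] at h
    rcases h with rfl | rfl | rfl <;> ring
  ne_zero := hp.2
  rot i j k := by rw [pointChirotope_eq, area_rot, pointChirotope_eq]
  swap i j k := by rw [pointChirotope_eq, area_swap, Left.sign_neg, pointChirotope_eq]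

theorem crossOnce_of_slope_ne {a b c d : ℝ} (h : b ≠ d) :
    CrossOnce (fun x => a + b * x) (fun x => c + d * x) := by
  have hbd : b - d ≠ 0 := sub_ne_zero.2 h
  have key : ∀ y, (a + b * y) - (c + d * y) = (b - d) * (y - (c - a) / (b - d)) := by
    intro y; field_simp; ring
  refine ⟨(c - a) / (b - d), ?_, ?_⟩
  · have := key ((c - a) / (b - d))
    rw [sub_self, mul_zero] at this
    exact sub_eq_zero.1 this
  · rcases h.lt_or_gt with h | h
    · right
      constructor <;> intro y hy <;> have := key y <;> dsimp only
      · have := mul_pos_of_neg_of_neg (sub_neg.2 h) (sub_neg.2 hy); linarith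
      · have := mul_neg_of_neg_of_pos (sub_neg.2 h) (sub_pos.2 hy); linarith
    · left
      constructor <;> intro y hy <;> have := key y <;> dsimp only
      · have := mul_neg_of_pos_of_neg (sub_pos.2 h) (sub_neg.2 hy); linarith
      · have := mul_pos (sub_pos.2 h) (sub_pos.2 hy); linarith

/-- The determinant of the difference vectors of two pairs of points. -/
def slopeDet (p q r s : ℝ × ℝ) : ℝ :=
  (q.1 - p.1) * (s.2 - r.2) - (q.2 - p.2) * (s.1 - r.1)

theorem area_eq_of_line {a b : ℝ} {p q r : ℝ × ℝ} (hp : a + b * p.1 = p.2)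
    (hq : a + b * q.1 = q.2) : area p q r = (q.1 - p.1) * (r.2 - (a + b * r.1)) := by
  rw [area, ← hp, ← hq]; ring

/-- A point set in general position with no vertical and no two parallel connecting lines spans
a generalized configuration. -/
theorem isAbstractChirotope_of_no_parallel {n : ℕ} {p : Fin n → ℝ × ℝ} (hp : GeneralPosition p)
    (hv : ∀ i j, i < j → (p j).1 - (p i).1 ≠ 0)
    (hpar : ∀ i j k l, i < j → k < l → (i, j) ≠ (k, l) → slopeDet (p i) (p j) (p k) (p l) ≠ 0) :
    IsAbstractChirotope (pointChirotope p) := by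
  have hinj : ∀ i j, i ≠ j → (p j).1 - (p i).1 ≠ 0 := by
    intro i j h
    rcases h.lt_or_gt with h | h
    · exact hv i j h
    · rw [← neg_sub]; exact neg_ne_zero.2 (hv j i h)
  let Ls : Set (ℝ → ℝ) := {f | ∃ i j, i < j ∧ OnCurve (p i) f ∧ OnCurve (p j) f ∧
    ∃ a b, f = fun x => a + b * x}
  have hon : ∀ f ∈ Ls, ∀ i j k, Distinct3 i j k → OnCurve (p i) f → OnCurve (p j) f →
      ¬ OnCurve (p k) f := by
    rintro f ⟨-, -, -, -, -, a, b, rfl⟩ i j k hd hi hj hk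
    apply hp.2 i j k hd
    rw [pointChirotope_eq, area_eq_of_line hi hj, (show a + b * (p k).1 = _ from hk), sub_self,
      mul_zero, sign_zero]
  let C : GeneralizedConfiguration n :=
    { pt := p
      lines := Ls
      pt_injective := hp.1
      continuous_of_mem := by
        rintro f ⟨-, -, -, -, -, a, b, rfl⟩
        fun_prop
      crossOnce := by
        rintro f ⟨i, j, hij, hi, hj, a, b, rfl⟩ g ⟨k, l, hkl, hk, hl, c, d, rfl⟩ hne
        simp only [OnCurve] at hi hj hk hl
        apply crossOnce_of_slope_ne
        rintro rfl
        by_cases h : (i, j) = (k, l)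
        · obtain ⟨rfl, rfl⟩ := Prod.mk.inj h
          apply hne
          have : a = c := by linarith
          rw [this]
        · apply hpar i j k l hij hkl h
          rw [slopeDet, ← hi, ← hj, ← hk, ← hl]; ring
      two_points := by
        intro f hf
        obtain ⟨i, j, hij, hi, hj, -⟩ := id hf
        rw [Set.ncard_eq_two]
        refine ⟨i, j, hij.ne, Set.ext fun k => ⟨fun hk => ?_, ?_⟩⟩
        · by_contra hk'
          simp only [Set.mem_insert_iff, Set.mem_singleton_iff, not_or] at hk'
          exact hon f hf i j k ⟨hij.ne, Ne.symm hk'.1, Ne.symm hk'.2⟩ hi hj hk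
        · rintro (rfl | rfl) <;> assumption
      exists_line := by
        have key : ∀ i j, i < j → ∃ f ∈ Ls, OnCurve (p i) f ∧ OnCurve (p j) f := by
          intro i j hij
          let b := ((p j).2 - (p i).2) / ((p j).1 - (p i).1)
          have hi : OnCurve (p i) (fun x => ((p i).2 - b * (p i).1) + b * x) := by
            simp [OnCurve]
          have hj : OnCurve (p j) (fun x => ((p i).2 - b * (p i).1) + b * x) := by
            have : b * ((p j).1 - (p i).1) = (p j).2 - (p i).2 := div_mul_cancel₀ _ (hv i j hij)
            simp only [OnCurve]; linarith
          exact ⟨_, ⟨i, j, hij, hi, hj, _, _, rfl⟩, hi, hj⟩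
        intro i j hij
        rcases hij.lt_or_gt with h | h
        · exact key i j h
        · obtain ⟨f, hf, h1, h2⟩ := key j i h
          exact ⟨f, hf, h2, h1⟩ }
  refine ⟨C, hp.isAlternating.eq_zero, ?_⟩
  rintro i j k - f ⟨-, -, -, -, -, a, b, rfl⟩ hi hj
  rw [pointChirotope_eq, area_eq_of_line (p := p i) (q := p j) hi hj, sign_mul]

/-- A nonzero polynomial has finitely many roots. The constant term may vanish, so continuity at `0`
would not suffice. -/
theorem eventually_quadratic_ne_zero (a b c : ℝ) (h : b ≠ 0 ∨ c ≠ 0) :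
    ∀ᶠ e in 𝓝[>] (0 : ℝ), a + b * e + c * e ^ 2 ≠ 0 := by
  open Polynomial in
  let P : ℝ[X] := C a + C b * X + C c * X ^ 2
  have hP : P ≠ 0 := by
    intro hP
    have h1 : P.coeff 1 = b := by simp [P, coeff_C]
    have h2 : P.coeff 2 = c := by simp [P]
    rw [hP] at h1 h2
    rcases h with h | h
    · exact h h1.symm
    · exact h h2.symm
  have hfin : {e : ℝ | P.IsRoot e}.Finite := Polynomial.finite_setOfPred_isRoot hP
  have hle : 𝓝[>] (0 : ℝ) ≤ cofinite :=
    (nhdsWithin_mono _ fun x hx => ne_of_gt hx).trans (nhdsNE_le_cofinite 0)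
  filter_upwards [hle hfin.compl_mem_cofinite] with e he h0
  exact he (by simpa [P, Polynomial.IsRoot] using h0)

theorem eventually_sign_eq {f : ℝ → ℝ} (hf : Continuous f) (h : f 0 ≠ 0) :
    ∀ᶠ e in 𝓝[>] (0 : ℝ), SignType.sign (f e) = SignType.sign (f 0) := by
  apply mem_nhdsWithin_of_mem_nhds
  rcases h.lt_or_gt with h | h
  · filter_upwards [hf.continuousAt.eventually_lt_const h] with e he
    rw [sign_neg he, sign_neg h]
  · filter_upwards [hf.continuousAt.eventually_const_lt h] with e he
    rw [sign_pos he, sign_pos h]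

/-- Uniqueness of binary expansions. The chord of the parabola `(t, t ^ 2)` between `t = 2 ^ i` and
`t = 2 ^ j` has slope `2 ^ i + 2 ^ j`, so distinct pairs give distinct slopes. -/
theorem two_pow_add_injOn {i j k l : ℕ} (hij : i < j) (hkl : k < l)
    (h : 2 ^ i + 2 ^ j = 2 ^ k + 2 ^ l) : i = k ∧ j = l := by
  have bound : ∀ {i j : ℕ}, i < j → 2 ^ j < 2 ^ i + 2 ^ j ∧ 2 ^ i + 2 ^ j < 2 ^ (j + 1) := by
    intro i j hij
    have h1 := Nat.two_pow_pos i
    have h2 := Nat.pow_lt_pow_right (a := 2) (by norm_num) hij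
    rw [pow_succ]; omega
  have hjl : j = l := by
    have h1 := bound hij
    have h2 := bound hkl
    rcases lt_trichotomy j l with hl | hl | hl
    · have := Nat.pow_le_pow_right (n := 2) (by norm_num) (Nat.succ_le_of_lt hl)
      simp only [Nat.succ_eq_add_one] at this; omega
    · exact hl
    · have := Nat.pow_le_pow_right (n := 2) (by norm_num) (Nat.succ_le_of_lt hl)
      simp only [Nat.succ_eq_add_one] at this; omega
  subst hjl
  exact ⟨Nat.pow_right_injective le_rfl (Nat.add_right_cancel h), rfl⟩

/-- Chirotopes of point sets are chirotopes of generalized configurations: a generic perturbation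
of the points has no vertical and no parallel connecting lines. -/
theorem GeneralPosition.isAbstractChirotope {n : ℕ} {p : Fin n → ℝ × ℝ}
    (hp : GeneralPosition p) : IsAbstractChirotope (pointChirotope p) := by
  -- Point `i` moves in the direction of the parabola point with parameter `2 ^ i`. The `e ^ 2`
  -- coefficient of `slopeDet` is then nonzero for distinct pairs, because the chords of the
  -- parabola have different slopes.
  let q : ℝ → Fin n → ℝ × ℝ := fun e i =>
    ((p i).1 + e * 2 ^ (i : ℕ), (p i).2 + e * (2 ^ (i : ℕ)) ^ 2)
  have h1 : ∀ᶠ e in 𝓝[>] (0 : ℝ), ∀ i j k, Distinct3 i j k →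
      pointChirotope (q e) i j k = pointChirotope p i j k := by
    simp only [eventually_all]
    intro i j k hd
    have := eventually_sign_eq (f := fun e => area (q e i) (q e j) (q e k))
      (by simp only [area, q]; fun_prop) (by
        have := hp.2 i j k hd
        rw [pointChirotope_eq, sign_ne_zero] at this
        simpa [q] using this)
    filter_upwards [this] with e he
    rw [pointChirotope_eq, pointChirotope_eq, he]
    simp [q]
  have pow_lt : ∀ i j : Fin n, i < j → (2 : ℝ) ^ (i : ℕ) < 2 ^ (j : ℕ) := fun i j h =>
    pow_lt_pow_right₀ (by norm_num) h
  have h2 : ∀ᶠ e in 𝓝[>] (0 : ℝ), ∀ i j, i < j → (q e j).1 - (q e i).1 ≠ 0 := by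
    simp only [eventually_all]
    intro i j hij
    filter_upwards [eventually_quadratic_ne_zero ((p j).1 - (p i).1)
      (2 ^ (j : ℕ) - 2 ^ (i : ℕ)) 0 (Or.inl (sub_ne_zero.2 (pow_lt i j hij).ne'))] with e he h0
    apply he
    refine Eq.trans ?_ h0
    simp only [q]; ring
  have h3 : ∀ᶠ e in 𝓝[>] (0 : ℝ), ∀ i j k l, i < j → k < l → (i, j) ≠ (k, l) →
      slopeDet (q e i) (q e j) (q e k) (q e l) ≠ 0 := by
    simp only [eventually_all]
    intro i j k l hij hkl hne
    set a : ℝ := 2 ^ (i : ℕ) with ha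
    set b : ℝ := 2 ^ (j : ℕ) with hb
    set c : ℝ := 2 ^ (k : ℕ) with hc
    set d : ℝ := 2 ^ (l : ℕ) with hd
    have hab : b - a ≠ 0 := sub_ne_zero.2 (pow_lt i j hij).ne'
    have hcd : d - c ≠ 0 := sub_ne_zero.2 (pow_lt k l hkl).ne'
    have hs : (c + d) - (a + b) ≠ 0 := by
      rw [sub_ne_zero]
      intro h
      have h' : 2 ^ (i : ℕ) + 2 ^ (j : ℕ) = 2 ^ (k : ℕ) + 2 ^ (l : ℕ) := by
        rw [ha, hb, hc, hd] at h
        exact_mod_cast h.symm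
      obtain ⟨h1, h2⟩ := two_pow_add_injOn hij hkl h'
      exact hne (Prod.ext (Fin.ext h1) (Fin.ext h2))
    filter_upwards [eventually_quadratic_ne_zero (slopeDet (p i) (p j) (p k) (p l))
      ((b - a) * ((p l).2 - (p k).2) + ((p j).1 - (p i).1) * (d ^ 2 - c ^ 2)
        - (b ^ 2 - a ^ 2) * ((p l).1 - (p k).1) - ((p j).2 - (p i).2) * (d - c))
      ((b - a) * (d - c) * ((c + d) - (a + b)))
      (Or.inr (mul_ne_zero (mul_ne_zero hab hcd) hs))] with e he h0
    apply he
    refine Eq.trans ?_ h0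
    simp only [q, slopeDet, ← ha, ← hb, ← hc, ← hd]; ring
  obtain ⟨e, he1, he2, he3⟩ := (h1.and (h2.and h3)).exists
  have hq : GeneralPosition (q e) := by
    refine ⟨fun i j hij => ?_, fun i j k hd => ?_⟩
    · by_contra hne
      rcases lt_or_gt_of_ne hne with h | h
      · exact he2 i j h (by rw [hij, sub_self])
      · exact he2 j i h (by rw [hij, sub_self])
    · rw [he1 i j k hd]; exact hp.2 i j k hd
  have heq : pointChirotope (q e) = pointChirotope p := by
    funext i j k
    by_cases hd : Distinct3 i j k
    · exact he1 i j k hd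
    · rw [hq.isAlternating.eq_zero _ _ _ hd, hp.isAlternating.eq_zero _ _ _ hd]
  rw [← heq]
  exact isAbstractChirotope_of_no_parallel hq he2 he3

/-! ### Indices in cyclic permutations -/

theorem index_pow_apply {n : ℕ} {σ : Equiv.Perm (Fin n)} {S : Finset (Fin n)}
    (hσ : σ.IsCycleOn S) {s : Fin n} (hs : s ∈ S) {r : ℕ} (hr : r < S.card) :
    index σ s ((σ ^ r) s) = r := by
  have hmem : r ∈ {t : ℕ | (σ ^ t) s = (σ ^ r) s} := rfl
  have h1 : (σ ^ index σ s ((σ ^ r) s)) s = (σ ^ r) s := Nat.sInf_mem ⟨r, hmem⟩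
  have h2 : index σ s ((σ ^ r) s) ≤ r := Nat.sInf_le hmem
  have h3 := (hσ.pow_apply_eq_pow_apply hs).1 h1
  rwa [Nat.ModEq, Nat.mod_eq_of_lt hr, Nat.mod_eq_of_lt (h2.trans_lt hr)] at h3

/-! ### Existence of radial systems -/

/-- The counterclockwise order around a point is a total cyclic order on the other points. -/
structure IsCyclicAround {n : ℕ} (i : Fin n) (c : Fin n → Fin n → Fin n → Prop) : Prop where
  rot : ∀ {j k l}, c j k l → c k l j
  asymm : ∀ {j k l}, j ≠ i → k ≠ i → l ≠ i → Distinct3 j k l → c j k l → ¬ c j l k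
  total : ∀ {j k l}, j ≠ i → k ≠ i → l ≠ i → Distinct3 j k l → c j k l ∨ c j l k
  trans : ∀ {s j k l}, s ≠ i → j ≠ i → k ≠ i → l ≠ i → Distinct3 s j k → Distinct3 s k l → j ≠ l →
    c s j k → c s k l → c s j l ∧ c j k l

theorem exists_equiv_of_total_order {X : Type*} [Fintype X] (r : X → X → Prop)
    (refl : ∀ x, r x x) (trans : ∀ x y z, r x y → r y z → r x z)
    (antisymm : ∀ x y, r x y → r y x → x = y) (total : ∀ x y, r x y ∨ r y x) :
    ∃ e : Fin (Fintype.card X) ≃ X, ∀ x y, x ≤ y → r (e x) (e y) := by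
  classical
  let lo : LinearOrder X :=
    { le := r
      le_refl := refl
      le_trans := trans
      le_antisymm := antisymm
      le_total := total
      toDecidableLE := Classical.decRel _ }
  let e : Fin (Fintype.card X) ≃o X := monoEquivOfFin X rfl
  exact ⟨e.toEquiv, fun x y h => e.monotone h⟩

/-- Cutting the cyclic order at some `s` gives a linear order; the permutation is the cycle of the
sorted list. -/
theorem IsCyclicAround.exists_perm {n : ℕ} {i : Fin n} {c : Fin n → Fin n → Fin n → Prop}
    (h : IsCyclicAround i c) :
    ∃ σ : Equiv.Perm (Fin n), σ.IsCycleOn {j | j ≠ i} ∧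
      ∀ j k l, j ≠ i → k ≠ i → l ≠ i → Distinct3 j k l →
        (c j k l ↔ index σ j k < index σ j l) := by
  classical
  by_cases hne : ∃ s, s ≠ i
  swap
  · push Not at hne
    refine ⟨1, ?_, fun j _ _ hj => absurd (hne j) hj⟩
    have : {j | j ≠ i} = (∅ : Set (Fin n)) := by
      ext j; simpa using hne j
    rw [this]
    exact Equiv.Perm.isCycleOn_empty
  obtain ⟨s, hs⟩ := hne
  let X := {x : Fin n // x ≠ i}
  -- The cut point `s` is made the least element.
  let r : X → X → Prop := fun x y => x = y ∨ x.1 = s ∨ (x.1 ≠ s ∧ y.1 ≠ s ∧ x ≠ y ∧ c s x y)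
  have r_trans : ∀ x y z, r x y → r y z → r x z := by
    rintro x y z (rfl | hx | ⟨hx, hy, hxy, hc⟩) hyz
    · exact hyz
    · exact Or.inr (Or.inl hx)
    · rcases hyz with rfl | h' | ⟨-, hz, hyz, hc'⟩
      · exact Or.inr (Or.inr ⟨hx, hy, hxy, hc⟩)
      · exact absurd h' hy
      · have hxy' : x.1 ≠ y.1 := fun e => hxy (Subtype.ext e)
        have hyz' : y.1 ≠ z.1 := fun e => hyz (Subtype.ext e)
        by_cases hxz : x = z
        · exact Or.inl hxz
        · exact Or.inr (Or.inr ⟨hx, hz, hxz, (h.trans hs x.2 y.2 z.2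
            ⟨Ne.symm hx, Ne.symm hy, hxy'⟩ ⟨Ne.symm hy, Ne.symm hz, hyz'⟩
            (fun e => hxz (Subtype.ext e)) hc hc').1⟩)
  have r_antisymm : ∀ x y, r x y → r y x → x = y := by
    rintro x y (h1 | h1 | ⟨hx, hy, hxy, hc⟩) (h2 | h2 | ⟨hy', hx', hyx, hc'⟩)
    · exact h1
    · exact h1
    · exact h1
    · exact h2.symm
    · exact Subtype.ext (h1.trans h2.symm)
    · exact absurd h1 hx'
    · exact h2.symm
    · exact absurd h2 hy
    · exact absurd hc' (h.asymm hs x.2 y.2 ⟨Ne.symm hx, Ne.symm hy,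
        fun e => hxy (Subtype.ext e)⟩ hc)
  have r_total : ∀ x y, r x y ∨ r y x := by
    intro x y
    by_cases hxy : x = y
    · exact Or.inl (Or.inl hxy)
    by_cases hx : x.1 = s
    · exact Or.inl (Or.inr (Or.inl hx))
    by_cases hy : y.1 = s
    · exact Or.inr (Or.inr (Or.inl hy))
    rcases h.total hs x.2 y.2 ⟨Ne.symm hx, Ne.symm hy, fun e => hxy (Subtype.ext e)⟩ with hc | hc
    · exact Or.inl (Or.inr (Or.inr ⟨hx, hy, hxy, hc⟩))
    · exact Or.inr (Or.inr (Or.inr ⟨hy, hx, Ne.symm hxy, hc⟩))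
  let m := Fintype.card X
  obtain ⟨e, he⟩ : ∃ e : Fin m ≃ X, ∀ x y, x ≤ y → r (e x) (e y) :=
    exists_equiv_of_total_order r (fun x => Or.inl rfl) r_trans r_antisymm r_total
  have hcard : (Finset.univ.erase i).card = m := by
    rw [Finset.card_erase_of_mem (Finset.mem_univ i), Finset.card_univ]
    simp only [m, X, Fintype.card_subtype_compl, Fintype.card_subtype_eq]
  let L : List (Fin n) := List.ofFn fun x => (e x).1
  have hlen : L.length = m := List.length_ofFn
  have hnd : L.Nodup := List.nodup_ofFn.2 fun x y hxy => e.injective (Subtype.ext hxy)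
  have hset : {a | a ∈ L} = {j | j ≠ i} := by
    ext j
    simp only [L, List.mem_ofFn, Set.mem_ofPred_eq]
    constructor
    · rintro ⟨x, rfl⟩; exact (e x).2
    · intro hj; exact ⟨e.symm ⟨j, hj⟩, by simp⟩
  have hcyc : L.formPerm.IsCycleOn {j | j ≠ i} := hset ▸ hnd.isCycleOn_formPerm
  have hcyc' : L.formPerm.IsCycleOn ((Finset.univ.erase i : Finset (Fin n)) : Set (Fin n)) := by
    convert hcyc using 1
    ext j; simp
  have hpow : ∀ (x : Fin m) (r : ℕ) (y : Fin m), (x + r) % m = y →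
      (L.formPerm ^ r) (e x).1 = (e y).1 := by
    intro x r y hy
    have := List.formPerm_pow_apply_getElem L hnd r x (by rw [hlen]; exact x.2)
    simp only [L, List.getElem_ofFn, List.length_ofFn, hy] at this
    exact this
  have hindex : ∀ x y : Fin m, index L.formPerm (e x).1 (e y).1 =
      if (x : ℕ) ≤ y then (y : ℕ) - x else y + m - x := by
    intro x y
    have hx := x.2
    have hy := y.2
    set r := if (x : ℕ) ≤ y then (y : ℕ) - x else y + m - x with hr
    have hr' : r < m := by
      rw [hr]; split_ifs <;> omega
    have h1 : (x + r) % m = y := by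
      rw [hr]; split_ifs with hxy
      · rw [Nat.add_sub_cancel' hxy, Nat.mod_eq_of_lt hy]
      · rw [show (x : ℕ) + (y + m - x) = y + m by omega, Nat.add_mod_right, Nat.mod_eq_of_lt hy]
    rw [← hpow x r y h1]
    exact index_pow_apply hcyc' (by simpa using (e x).2) (by rw [hcard]; exact hr')
  have hmono : ∀ x y z : Fin m, x < y → y < z → c (e x) (e y) (e z) := by
    have hlt : ∀ x y : Fin m, x < y → (e y).1 ≠ s ∧ ((e x).1 = s ∨
        ((e x).1 ≠ s ∧ c s (e x) (e y))) := by
      intro x y hxy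
      have hne : e x ≠ e y := fun h => hxy.ne (e.injective h)
      have hle := he x y hxy.le
      have hnle : ¬ r (e y) (e x) := fun h => hne (r_antisymm _ _ hle h)
      refine ⟨fun hy => hnle (Or.inr (Or.inl hy)), ?_⟩
      rcases hle with h1 | h1 | ⟨h1, -, -, h2⟩
      · exact absurd h1 hne
      · exact Or.inl h1
      · exact Or.inr ⟨h1, h2⟩
    intro x y z hxy hyz
    have hne : ∀ {x y : Fin m}, x < y → (e x).1 ≠ (e y).1 := fun h h' =>
      h.ne (e.injective (Subtype.ext h'))
    obtain ⟨hy, h1⟩ := hlt x y hxy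
    obtain ⟨hz, h2⟩ := hlt y z hyz
    have h2 := (h2.resolve_left hy).2
    rcases h1 with h1 | ⟨hx, h1⟩
    · rw [h1]; exact h2
    · exact (h.trans hs (e x).2 (e y).2 (e z).2 ⟨Ne.symm hx, Ne.symm hy, hne hxy⟩
        ⟨Ne.symm hy, Ne.symm hz, hne hyz⟩ (hne (hxy.trans hyz)) h1 h2).2
  refine ⟨L.formPerm, hcyc, fun j k l hj hk hl hd => ?_⟩
  obtain ⟨x, hx⟩ := e.surjective ⟨j, hj⟩
  obtain ⟨y, hy⟩ := e.surjective ⟨k, hk⟩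
  obtain ⟨z, hz⟩ := e.surjective ⟨l, hl⟩
  have ex : (e x).1 = j := by rw [hx]
  have ey : (e y).1 = k := by rw [hy]
  have ez : (e z).1 = l := by rw [hz]
  have hxy : x ≠ y := fun h => hd.1 (by rw [← ex, ← ey, h])
  have hxz : x ≠ z := fun h => hd.2.1 (by rw [← ex, ← ez, h])
  have hyz : y ≠ z := fun h => hd.2.2 (by rw [← ey, ← ez, h])
  have pos : ∀ {x y z : Fin m}, (x < y ∧ y < z) ∨ (y < z ∧ z < x) ∨ (z < x ∧ x < y) →
      c (e x) (e y) (e z) := by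
    rintro x y z (⟨h1, h2⟩ | ⟨h1, h2⟩ | ⟨h1, h2⟩)
    · exact hmono _ _ _ h1 h2
    · exact h.rot (h.rot (hmono _ _ _ h1 h2))
    · exact h.rot (hmono _ _ _ h1 h2)
  have iff_pos : c j k l ↔ (x < y ∧ y < z) ∨ (y < z ∧ z < x) ∨ (z < x ∧ x < y) := by
    constructor
    · intro hc
      by_contra hnot
      have : c j l k := by
        rw [← ex, ← ey, ← ez]
        apply pos
        rcases lt_or_gt_of_ne hxy with h1 | h1 <;> rcases lt_or_gt_of_ne hxz with h2 | h2 <;>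
          rcases lt_or_gt_of_ne hyz with h3 | h3 <;> tauto
      exact h.asymm hj hk hl hd hc this
    · intro hc
      rw [← ex, ← ey, ← ez]
      exact pos hc
  rw [iff_pos, ← ex, ← ey, ← ez, hindex, hindex]
  have hx := x.2
  have hy := y.2
  have hz := z.2
  rw [Ne, Fin.ext_iff] at hxy hxz hyz
  simp only [Fin.lt_def]
  split_ifs <;> omega

section CcwAround

variable {n : ℕ} {χ : Chirotope n}

theorem IsAlternating.rev (h : IsAlternating χ) (i j k : Fin n) : χ i k j = -χ i j k := by
  rw [h.rot j i k, h.swap, h.rot]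

theorem CcwAround.rot {i j k l : Fin n} (h : CcwAround χ i j k l) : CcwAround χ i k l j := by
  unfold CcwAround at *
  tauto

/-- `CcwAround` is a majority vote of three nonzero signs, and reversing the order negates all
three. -/
theorem IsAlternating.ccwAround_rev (h : IsAlternating χ) {i j k l : Fin n} (hj : j ≠ i)
    (hk : k ≠ i) (hl : l ≠ i) (hd : Distinct3 j k l) :
    CcwAround χ i j l k ↔ ¬ CcwAround χ i j k l := by
  have h1 := h.ne_zero i j k ⟨hj.symm, hk.symm, hd.1⟩
  have h2 := h.ne_zero i k l ⟨hk.symm, hl.symm, hd.2.2⟩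
  have h3 := h.ne_zero i j l ⟨hj.symm, hl.symm, hd.2.1⟩
  unfold CcwAround
  rw [h.rev i j l, h.rev i k l, h.rev i j k]
  generalize χ i j k = x at *
  generalize χ i k l = y at *
  generalize χ i j l = z at *
  revert x y z; decide

end CcwAround

theorem SignType.eq_one_or_of_ne_zero {x : SignType} (h : x ≠ 0) : x = 1 ∨ x = -1 := by
  revert x; decide

theorem GeneralPosition.isCyclicAround {n : ℕ} {p : Fin n → ℝ × ℝ} (hp : GeneralPosition p)
    (i : Fin n) : IsCyclicAround i (CcwAround (pointChirotope p) i) := by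
  have hA := hp.isAlternating
  set χ := pointChirotope p with hχ
  refine ⟨CcwAround.rot, ?_, ?_, ?_⟩
  · intro j k l hj hk hl hd h h'
    exact (hA.ccwAround_rev hj hk hl hd).1 h' h
  · intro j k l hj hk hl hd
    rw [hA.ccwAround_rev hj hk hl hd]
    exact em _
  · intro s j k l hsi hj hk hl hd1 hd2 hjl
    have h1 := hA.ne_zero i s j ⟨hsi.symm, hj.symm, hd1.1⟩
    have h2 := hA.ne_zero i s k ⟨hsi.symm, hk.symm, hd1.2.1⟩
    have h3 := hA.ne_zero i s l ⟨hsi.symm, hl.symm, hd2.2.1⟩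
    have h4 := hA.ne_zero i j k ⟨hj.symm, hk.symm, hd1.2.2⟩
    have h5 := hA.ne_zero i k l ⟨hk.symm, hl.symm, hd2.2.2⟩
    have h6 := hA.ne_zero i j l ⟨hj.symm, hl.symm, hjl⟩
    -- The Grassmann–Plücker relation: the three signed products sum to zero, so they cannot all
    -- have the same sign. Transitivity then holds in each of the remaining sign patterns.
    have hgp : area (p i) (p s) (p j) * area (p i) (p k) (p l)
        - area (p i) (p s) (p k) * area (p i) (p j) (p l)
        + area (p i) (p s) (p l) * area (p i) (p j) (p k) = 0 := by
      simp only [area]; ring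
    have g1 : ¬ (χ i s j * χ i k l = 1 ∧ χ i s k * χ i j l = -1 ∧ χ i s l * χ i j k = 1) := by
      simp only [hχ, pointChirotope_eq, ← sign_mul, sign_eq_one_iff, sign_eq_neg_one_iff]
      rintro ⟨h1, h2, h3⟩
      linarith
    have g2 : ¬ (χ i s j * χ i k l = -1 ∧ χ i s k * χ i j l = 1 ∧ χ i s l * χ i j k = -1) := by
      simp only [hχ, pointChirotope_eq, ← sign_mul, sign_eq_one_iff, sign_eq_neg_one_iff]
      rintro ⟨h1, h2, h3⟩
      linarith
    unfold CcwAround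
    rw [hA.rev i s k, hA.rev i s l, hA.rev i j l]
    rcases SignType.eq_one_or_of_ne_zero h1 with h1 | h1 <;>
    rcases SignType.eq_one_or_of_ne_zero h2 with h2 | h2 <;>
    rcases SignType.eq_one_or_of_ne_zero h3 with h3 | h3 <;>
    rcases SignType.eq_one_or_of_ne_zero h4 with h4 | h4 <;>
    rcases SignType.eq_one_or_of_ne_zero h5 with h5 | h5 <;>
    rcases SignType.eq_one_or_of_ne_zero h6 with h6 | h6 <;>
    rw [h1, h2, h3, h4, h5, h6] at g1 g2 ⊢ <;>
    first
    | decide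
    | exact absurd (by decide) g1
    | exact absurd (by decide) g2

/-- Every labeled point set in general position has a radial system. -/
theorem GeneralPosition.exists_isRadialSystemOf {n : ℕ} {p : Fin n → ℝ × ℝ}
    (hp : GeneralPosition p) : ∃ R, IsRadialSystemOf (pointChirotope p) R := by
  choose R hR using fun i => (hp.isCyclicAround i).exists_perm
  exact ⟨R, hR⟩

/-! ### Answers to queries -/

section Index

variable {n : ℕ} {χ χ' : Chirotope n} {R R' : RotationSystem n}

theorem IsRadialSystemOf.isCycleOn_erase (h : IsRadialSystemOf χ R) (i : Fin n) :
    (R i).IsCycleOn ((Finset.univ.erase i : Finset (Fin n)) : Set (Fin n)) := by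
  convert (h i).1 using 1
  ext j; simp

theorem IsRadialSystemOf.pow_apply_self (h : IsRadialSystemOf χ R) (i : Fin n) (r : ℕ) :
    ((R i) ^ r) i = i := by
  have h1 : R i i = i := by
    by_contra hne
    obtain ⟨j, hj, hji⟩ := (h i).1.1.surjOn (show R i i ∈ {j | j ≠ i} from hne)
    exact hj ((R i).injective hji)
  induction r with
  | zero => rfl
  | succ r ih => rw [pow_succ, Equiv.Perm.mul_apply, h1, ih]

theorem IsRadialSystemOf.exists_index (h : IsRadialSystemOf χ R) {i s j : Fin n} (hs : s ≠ i)
    (hj : j ≠ i) :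
    ((R i) ^ index (R i) s j) s = j ∧ index (R i) s j < (Finset.univ.erase i).card := by
  have hs' : s ∈ Finset.univ.erase i := by simpa using hs
  obtain ⟨r, hr, rfl⟩ := (h.isCycleOn_erase i).exists_pow_eq hs'
    (show j ∈ Finset.univ.erase i by simpa using hj)
  rw [index_pow_apply (h.isCycleOn_erase i) hs' hr]
  exact ⟨rfl, hr⟩

open Classical in
/-- The index of `j` counted from `s` is determined by the points between `s` and `j`. -/
theorem IsRadialSystemOf.index_eq_card (h : IsRadialSystemOf χ R) {i s j : Fin n} (hs : s ≠ i)
    (hj : j ≠ i) (hsj : s ≠ j) :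
    index (R i) s j =
      (Finset.univ.filter fun k => k ≠ i ∧ k ≠ s ∧ k ≠ j ∧ CcwAround χ i s k j).card + 1 := by
  have hc := h.isCycleOn_erase i
  have hs' : s ∈ Finset.univ.erase i := by simpa using hs
  obtain ⟨ht1, ht2⟩ := h.exists_index hs hj
  set t := index (R i) s j with ht
  have hcard : ((Finset.range t).image fun r => ((R i) ^ r) s).card = t := by
    rw [Finset.card_image_of_injOn, Finset.card_range]
    intro a ha b hb hab
    have ha := (Finset.mem_range.1 ha).trans ht2
    have hb := (Finset.mem_range.1 hb).trans ht2
    rw [← index_pow_apply hc hs' ha, ← index_pow_apply hc hs' hb]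
    exact congrArg _ hab
  have himage : ((Finset.range t).image fun r => ((R i) ^ r) s) =
      insert s (Finset.univ.filter fun k => k ≠ i ∧ k ≠ s ∧ k ≠ j ∧ CcwAround χ i s k j) := by
    ext k
    simp only [Finset.mem_image, Finset.mem_range, Finset.mem_insert, Finset.mem_filter,
      Finset.mem_univ, true_and]
    have hss : index (R i) s s = 0 := by
      have := index_pow_apply (r := 0) hc hs' ((Nat.zero_le _).trans_lt ht2)
      simpa using this
    constructor
    · rintro ⟨r, hr, rfl⟩
      by_cases hks : ((R i) ^ r) s = s
      · exact Or.inl hks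
      · have hidx := index_pow_apply hc hs' (hr.trans ht2)
        have hki : ((R i) ^ r) s ≠ i := by
          intro e
          have : ((R i) ^ r) s = ((R i) ^ r) i := by rw [e, h.pow_apply_self]
          exact hs (((R i) ^ r).injective this)
        have hkj : ((R i) ^ r) s ≠ j := by
          intro e
          rw [e] at hidx
          omega
        refine Or.inr ⟨hki, hks, hkj, ?_⟩
        rw [(h i).2 s _ j hs hki hj ⟨Ne.symm hks, hsj, hkj⟩, hidx]
        exact hr
    · rintro (rfl | ⟨hki, hks, hkj, hccw⟩)
      · refine ⟨0, Nat.pos_of_ne_zero fun h0 => ?_, rfl⟩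
        rw [h0] at ht1
        exact hsj ht1
      · rw [(h i).2 s _ j hs hki hj ⟨Ne.symm hks, hsj, hkj⟩] at hccw
        exact ⟨_, hccw, (h.exists_index hs hki).1⟩
  rw [← hcard, himage, Finset.card_insert_of_notMem (by simp)]

/-- The orientation functions differ at most on triples that contain both `y` and `z`. -/
def AgreeOff (χ χ' : Chirotope n) (y z : Fin n) : Prop :=
  ∀ i j k, (y = i ∨ y = j ∨ y = k) ∧ (z = i ∨ z = j ∨ z = k) ∨ χ i j k = χ' i j k

/-- The point `k` may be `y` or `z`, but it is the only one of the four that can be, so no triple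
involved contains both. -/
theorem AgreeOff.ccwAround_iff {y z : Fin n} (h : AgreeOff χ χ' y z) (hyz : y ≠ z)
    {i s j : Fin n} (hi : i ≠ y ∧ i ≠ z) (hs : s ≠ y ∧ s ≠ z) (hj : j ≠ y ∧ j ≠ z) (k : Fin n) :
    CcwAround χ i s k j ↔ CcwAround χ' i s k j := by
  have h1 := (h i s k).resolve_left (by grind)
  have h2 := (h i k j).resolve_left (by grind)
  have h3 := (h i j s).resolve_left (by grind)
  rw [CcwAround, CcwAround, h1, h2, h3]

theorem AgreeOff.index_eq {y z : Fin n} (h : AgreeOff χ χ' y z) (hyz : y ≠ z)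
    (hR : IsRadialSystemOf χ R) (hR' : IsRadialSystemOf χ' R') {i s j : Fin n}
    (hi : i ≠ y ∧ i ≠ z) (hs : s ≠ y ∧ s ≠ z) (hj : j ≠ y ∧ j ≠ z) :
    index (R i) s j = index (R' i) s j := by
  by_cases hsj : s = j
  · subst hsj
    have : ∀ σ : Equiv.Perm (Fin n), index σ s s = 0 := fun σ =>
      Nat.sInf_eq_zero.2 (Or.inl rfl)
    rw [this, this]
  by_cases hsi : s = i
  · subst hsi
    -- Degenerate indices: the rotation fixes its centre, so the other label is never reached and
    -- the infimum of the empty set is `0`. The case `j = i` below is analogous.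
    have : ∀ {χ : Chirotope n} {R : RotationSystem n}, IsRadialSystemOf χ R →
        index (R s) s j = 0 := fun h => Nat.sInf_eq_zero.2 (Or.inr (by
      ext r
      simpa [h.pow_apply_self s r] using hsj))
    rw [this hR, this hR']
  by_cases hji : j = i
  · subst hji
    have : ∀ {χ : Chirotope n} {R : RotationSystem n}, IsRadialSystemOf χ R →
        index (R j) s j = 0 := fun h => Nat.sInf_eq_zero.2 (Or.inr (by
      ext r
      simp only [Set.mem_ofPred_eq, Set.mem_empty_iff_false, iff_false]
      intro e
      exact hsj (Equiv.injective _ (e.trans (h.pow_apply_self j r).symm))))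
    rw [this hR, this hR']
  classical
  rw [hR.index_eq_card hsi hji hsj, hR'.index_eq_card hsi hji hsj]
  congr 2
  ext k
  simp only [Finset.mem_filter, h.ccwAround_iff hyz hi hs hj]

theorem AgreeOff.pow_apply_eq {y z : Fin n} (h : AgreeOff χ χ' y z) (hyz : y ≠ z)
    (hR : IsRadialSystemOf χ R) (hR' : IsRadialSystemOf χ' R') {i s : Fin n} {r : ℕ}
    (hi : i ≠ y ∧ i ≠ z) (hs : s ≠ y ∧ s ≠ z) (hj : (R i ^ r) s ≠ y ∧ (R i ^ r) s ≠ z) :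
    (R i ^ r) s = (R' i ^ r) s := by
  by_cases hsi : s = i
  · subst hsi
    rw [hR.pow_apply_self, hR'.pow_apply_self]
  have hji : (R i ^ r) s ≠ i := fun e =>
    hsi (((R i) ^ r).injective (e.trans (hR.pow_apply_self i r).symm))
  have hs' : s ∈ Finset.univ.erase i := by simpa using hsi
  have h1 := (hR.exists_index hsi hji).1
  have h2 := (hR'.exists_index hsi hji).1
  rw [← h.index_eq hyz hR hR' hi hs hj] at h2
  -- The position `r` may exceed the cycle length; it is congruent to the common index modulo that
  -- length, which is the same for both rotations.
  rw [(hR.isCycleOn_erase i).pow_apply_eq_pow_apply hs',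
    ← (hR'.isCycleOn_erase i).pow_apply_eq_pow_apply hs'] at h1
  rw [← h1, h2]

/-- The pairs of labels `2m, 2m+1` touched by a query or by its answer on `R`. -/
noncomputable def Query.touched (R : RotationSystem n) : Query n → Finset ℕ
  | .tripleTest i j k l => {(i : ℕ) / 2, (j : ℕ) / 2, (k : ℕ) / 2, (l : ℕ) / 2}
  | .indexOf i s j => {(i : ℕ) / 2, (s : ℕ) / 2, (j : ℕ) / 2}
  | .entryAt i s r => {(i : ℕ) / 2, (s : ℕ) / 2, ((R i ^ r) s : ℕ) / 2}

theorem Query.card_touched_le (R : RotationSystem n) (q : Query n) : (q.touched R).card ≤ 4 := by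
  cases q
  · exact Finset.card_le_four
  · exact Finset.card_le_three.trans (by norm_num)
  · exact Finset.card_le_three.trans (by norm_num)

theorem Query.answer_eq {y z : Fin n} {m : ℕ} (hy : (y : ℕ) / 2 = m) (hz : (z : ℕ) / 2 = m)
    (h : AgreeOff χ χ' y z) (hyz : y ≠ z) (hR : IsRadialSystemOf χ R)
    (hR' : IsRadialSystemOf χ' R') (q : Query n) (hq : m ∉ q.touched R) :
    q.answer R = q.answer R' := by
  have key : ∀ {i : Fin n}, m ≠ (i : ℕ) / 2 → i ≠ y ∧ i ≠ z := by
    intro i hi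
    constructor
    · rintro rfl; exact hi hy.symm
    · rintro rfl; exact hi hz.symm
  cases q with
  | tripleTest i j k l =>
    simp only [touched, Finset.mem_insert, Finset.mem_singleton, not_or] at hq
    obtain ⟨hi, hj, hk, hl⟩ := hq
    simp only [answer]
    rw [h.index_eq hyz hR hR' (key hi) (key hj) (key hk),
      h.index_eq hyz hR hR' (key hi) (key hj) (key hl)]
  | indexOf i s j =>
    simp only [touched, Finset.mem_insert, Finset.mem_singleton, not_or] at hq
    obtain ⟨hi, hs, hj⟩ := hq
    exact h.index_eq hyz hR hR' (key hi) (key hs) (key hj)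
  | entryAt i s r =>
    simp only [touched, Finset.mem_insert, Finset.mem_singleton, not_or] at hq
    obtain ⟨hi, hs, hj⟩ := hq
    exact h.pow_apply_eq hyz hR hR' (key hi) (key hs) (key hj)

/-- An algorithm that asks few queries cannot notice the modification of most pairs. -/
theorem Algorithm.exists_touched (R : RotationSystem n) (A : Algorithm n) :
    ∃ S : Finset ℕ, S.card ≤ 4 * A.numQueries R ∧ ∀ R' : RotationSystem n, ∀ m ∉ S,
      (∀ q : Query n, m ∉ q.touched R → q.answer R = q.answer R') → A.run R' = A.run R := by
  classical
  induction A with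
  | output k => exact ⟨∅, by simp, fun _ _ _ _ => rfl⟩
  | ask q next ih =>
    -- Only the branch taken on `R` matters: `S` collects the levels touched along it.
    obtain ⟨S, hS, h⟩ := ih (q.answer R)
    refine ⟨q.touched R ∪ S, ?_, fun R' m hm hq => ?_⟩
    · have := Finset.card_union_le (q.touched R) S
      have := q.card_touched_le R
      simp only [numQueries]
      omega
    · rw [Finset.mem_union, not_or] at hm
      simp only [run]
      rw [← hq q hm.1]
      exact h R' m hm.2 hq

end Index

/-! ### Reconstruction from the radial system -/

section Reconstruction

variable {n : ℕ} {χ ψ : Chirotope n}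

theorem IsAlternating.distinct (h : IsAlternating χ) {i j k : Fin n} {s : SignType}
    (hs : χ i j k = s) (h0 : s ≠ 0 := by decide) : Distinct3 i j k := by
  by_contra hd
  exact h0 (hs.symm.trans (h.eq_zero i j k hd))

/-- Alternating functions are compared on increasing triples. -/
theorem IsAlternating.eq_of_sorted (hχ : IsAlternating χ) (hψ : IsAlternating ψ)
    {Q : Fin n → Fin n → Fin n → Prop} (hrot : ∀ i j k, Q i j k → Q j k i)
    (hswap : ∀ i j k, Q i j k → Q j i k)
    (h : ∀ i j k, i < j → j < k → Q i j k ∨ χ i j k = ψ i j k) (i j k : Fin n) :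
    Q i j k ∨ χ i j k = ψ i j k := by
  have rot : ∀ {i j k}, Q i j k ∨ χ i j k = ψ i j k → Q j k i ∨ χ j k i = ψ j k i := by
    rintro i j k (h | h)
    · exact Or.inl (hrot _ _ _ h)
    · exact Or.inr (by rw [hχ.rot, hψ.rot, h])
  have swap : ∀ {i j k}, Q i j k ∨ χ i j k = ψ i j k → Q j i k ∨ χ j i k = ψ j i k := by
    rintro i j k (h | h)
    · exact Or.inl (hswap _ _ _ h)
    · exact Or.inr (by rw [hχ.swap, hψ.swap, h])
  by_cases hd : Distinct3 i j k
  · obtain ⟨hij, hik, hjk⟩ := hd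
    rcases hij.lt_or_gt with h1 | h1 <;> rcases hik.lt_or_gt with h2 | h2 <;>
      rcases hjk.lt_or_gt with h3 | h3
    · exact h _ _ _ h1 h3
    · exact rot (swap (h _ _ _ h2 h3))
    · exact absurd (h1.trans (h3.trans h2)) (lt_irrefl _)
    · exact rot (h _ _ _ h2 h1)
    · exact swap (h _ _ _ h1 h2)
    · exact absurd (h1.trans (h2.trans h3)) (lt_irrefl _)
    · exact rot (rot (h _ _ _ h3 h2))
    · exact swap (rot (h _ _ _ h3 h1))
  · exact Or.inr (by rw [hχ.eq_zero _ _ _ hd, hψ.eq_zero _ _ _ hd])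

/-- The two orientation functions have the same cyclic orders around all points. -/
def SameRadial (χ ψ : Chirotope n) : Prop :=
  ∀ i j k l, j ≠ i → k ≠ i → l ≠ i → Distinct3 j k l → (CcwAround χ i j k l ↔ CcwAround ψ i j k l)

theorem IsRadialSystemOf.sameRadial {R : RotationSystem n} (h : IsRadialSystemOf χ R)
    (h' : IsRadialSystemOf ψ R) : SameRadial χ ψ := fun i j k l hj hk hl hd =>
  ((h i).2 j k l hj hk hl hd).trans ((h' i).2 j k l hj hk hl hd).symm

theorem SameRadial.isRadialSystemOf {R : RotationSystem n} (h : SameRadial χ ψ)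
    (h' : IsRadialSystemOf χ R) : IsRadialSystemOf ψ R := fun i =>
  ⟨(h' i).1, fun j k l hj hk hl hd =>
    (h i j k l hj hk hl hd).symm.trans ((h' i).2 j k l hj hk hl hd)⟩

/-- The orientations of a quadruple in convex position are determined by the radial system. -/
theorem SameRadial.convex (h : SameRadial χ ψ) (hχ : IsAlternating χ) (hψ : IsAlternating ψ)
    {a b c d : Fin n} (h1 : χ a b c = 1) (h2 : χ a b d = 1) (h3 : χ a c d = 1)
    (h4 : χ b c d = 1) : ψ a b c = 1 ∧ ψ a b d = 1 ∧ ψ a c d = 1 ∧ ψ b c d = 1 := by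
  obtain ⟨hab, hac, hbc⟩ := hχ.distinct h1
  obtain ⟨-, had, hbd⟩ := hχ.distinct h2
  obtain ⟨-, -, hcd⟩ := hχ.distinct h3
  have q1 := h a b c d hab.symm hac.symm had.symm ⟨hbc, hbd, hcd⟩
  have q2 := h b c d a hbc.symm hbd.symm hab ⟨hcd, hac.symm, had.symm⟩
  have q3 := h c d a b hcd.symm hac hbc ⟨had.symm, hbd.symm, hab⟩
  have q4 := h d a b c had hbd hcd ⟨hab, hac, hbc⟩
  have n1 := hψ.ne_zero a b c ⟨hab, hac, hbc⟩
  have n2 := hψ.ne_zero a b d ⟨hab, had, hbd⟩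
  have n3 := hψ.ne_zero a c d ⟨hac, had, hcd⟩
  have n4 := hψ.ne_zero b c d ⟨hbc, hbd, hcd⟩
  have norm : ∀ {χ : Chirotope n}, IsAlternating χ →
      χ a d b = -χ a b d ∧ χ b d a = χ a b d ∧ χ b a c = -χ a b c ∧ χ c d a = χ a c d ∧
      χ c a b = χ a b c ∧ χ c b d = -χ b c d ∧ χ d a b = χ a b d ∧ χ d b c = χ b c d ∧
      χ d c a = -χ a c d := fun {χ} hA =>
    ⟨hA.rev .., hA.rot .., hA.swap .., hA.rot .., (hA.rot ..).trans (hA.rot ..), hA.swap ..,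
      (hA.rot ..).trans (hA.rot ..), (hA.rot ..).trans (hA.rot ..), by
        rw [hA.rot a d c, hA.rev]⟩
  obtain ⟨e1, e2, e3, e4, e5, e6, e7, e8, e9⟩ := norm hχ
  obtain ⟨f1, f2, f3, f4, f5, f6, f7, f8, f9⟩ := norm hψ
  simp only [CcwAround, e1, e2, e3, e4, e5, e6, e7, e8, e9, f1, f2, f3, f4, f5, f6, f7, f8, f9,
    h1, h2, h3, h4] at q1 q2 q3 q4
  generalize ψ a b c = x1 at *
  generalize ψ a b d = x2 at *
  generalize ψ a c d = x3 at *
  generalize ψ b c d = x4 at *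
  clear * - q1 q2 q3 q4 n1 n2 n3 n4
  replace q1 := q1.1 (by decide)
  replace q2 := q2.1 (by decide)
  replace q3 := q3.1 (by decide)
  replace q4 := q4.1 (by decide)
  -- Among the sixteen sign patterns of `ψ`, only the all-positive one has these rotations at all
  -- four points.
  rcases SignType.eq_one_or_of_ne_zero n1 with rfl | rfl <;>
  rcases SignType.eq_one_or_of_ne_zero n2 with rfl | rfl <;>
  rcases SignType.eq_one_or_of_ne_zero n3 with rfl | rfl <;>
  rcases SignType.eq_one_or_of_ne_zero n4 with rfl | rfl <;>
  revert q1 q2 q3 q4 <;> decide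

/-- In a quadruple with a point `d` inside the triangle `a b c`, the orientation of the triangle
determines the other orientations. -/
theorem SameRadial.inner (h : SameRadial χ ψ) (hχ : IsAlternating χ) (hψ : IsAlternating ψ)
    {a b c d : Fin n} (h1 : χ a b c = 1) (h2 : χ a b d = 1) (h3 : χ b c d = 1)
    (h4 : χ c a d = 1) (h5 : ψ a b c = 1) : ψ a b d = 1 ∧ ψ b c d = 1 ∧ ψ c a d = 1 := by
  obtain ⟨hab, hac, hbc⟩ := hχ.distinct h1
  obtain ⟨-, had, hbd⟩ := hχ.distinct h2
  obtain ⟨-, hcd, -⟩ := hχ.distinct h4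
  have q1 := h a b d c hab.symm had.symm hac.symm ⟨hbd, hbc, hcd.symm⟩
  have q2 := h b c d a hbc.symm hbd.symm hab ⟨hcd, hac.symm, had.symm⟩
  have q3 := h c a d b hac hcd.symm hbc ⟨had, hab, hbd.symm⟩
  have n2 := hψ.ne_zero a b d ⟨hab, had, hbd⟩
  have n3 := hψ.ne_zero b c d ⟨hbc, hbd, hcd⟩
  have n4 := hψ.ne_zero c a d ⟨hac.symm, hcd, had⟩
  have norm : ∀ {χ : Chirotope n}, IsAlternating χ →
      χ a d c = χ c a d ∧ χ a c b = -χ a b c ∧ χ b d a = χ a b d ∧ χ b a c = -χ a b c ∧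
      χ c d b = χ b c d ∧ χ c b a = -χ a b c := fun {χ} hA =>
    ⟨hA.rot .., hA.rev .., hA.rot .., hA.swap .., hA.rot .., by rw [hA.rot a c b, hA.rev]⟩
  obtain ⟨e1, e2, e3, e4, e5, e6⟩ := norm hχ
  obtain ⟨f1, f2, f3, f4, f5, f6⟩ := norm hψ
  simp only [CcwAround, e1, e2, e3, e4, e5, e6, f1, f2, f3, f4, f5, f6, h1, h2, h3, h4, h5]
    at q1 q2 q3
  generalize ψ a b d = x2 at *
  generalize ψ b c d = x3 at *
  generalize ψ c a d = x4 at *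
  clear * - q1 q2 q3 n2 n3 n4
  rcases SignType.eq_one_or_of_ne_zero n2 with rfl | rfl <;>
  rcases SignType.eq_one_or_of_ne_zero n3 with rfl | rfl <;>
  rcases SignType.eq_one_or_of_ne_zero n4 with rfl | rfl <;>
  revert q1 q2 q3 <;> decide

/-- Reading the quadruple backwards negates all four orientations and reduces to
`SameRadial.convex`. -/
theorem SameRadial.convex_neg (h : SameRadial χ ψ) (hχ : IsAlternating χ) (hψ : IsAlternating ψ)
    {a b c d : Fin n} (h1 : χ a b c = -1) (h2 : χ a b d = -1) (h3 : χ a c d = -1)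
    (h4 : χ b c d = -1) : ψ a b c = -1 ∧ ψ a b d = -1 ∧ ψ a c d = -1 ∧ ψ b c d = -1 := by
  have rev : ∀ {χ : Chirotope n}, IsAlternating χ → ∀ i j k, χ k j i = -χ i j k := by
    intro χ hA i j k
    rw [hA.rot i k j, hA.rev]
  have := h.convex hχ hψ (a := d) (b := c) (c := b) (d := a)
    (by rw [rev hχ, h4, neg_neg]) (by rw [rev hχ, h3, neg_neg]) (by rw [rev hχ, h2, neg_neg])
    (by rw [rev hχ, h1, neg_neg])
  obtain ⟨g1, g2, g3, g4⟩ := this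
  rw [rev hψ] at g1 g2 g3 g4
  exact ⟨neg_eq_iff_eq_neg.1 g4, neg_eq_iff_eq_neg.1 g3, neg_eq_iff_eq_neg.1 g2,
    neg_eq_iff_eq_neg.1 g1⟩

end Reconstruction

/-! ### Ladders -/

/-- The orientation functions of the lower bound. The labels `2h, 2h+1` with `h ≥ 1` are two close
points at level `h`; label `0` lies to the left and label `1` to the right of all connecting lines
of points at different levels. The line from `0` to `1` passes below (`s = 1`) or above (`s = -1`)
all other points, and `0` lies to the left (`ε h = 1`) or to the right (`ε h = -1`) of the
connecting line of the two points at level `h`. -/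
structure IsLadder {n : ℕ} (χ : Chirotope n) (s : SignType) (ε : ℕ → SignType) : Prop where
  alt : IsAlternating χ
  base : ∀ {a b u : Fin n}, a.val = 0 → b.val = 1 → 2 ≤ u.val → χ a b u = s
  left_level : ∀ {a u v : Fin n}, a.val = 0 → 2 ≤ u.val → u.val / 2 < v.val / 2 → χ a u v = 1
  left_twin : ∀ {a u v : Fin n}, a.val = 0 → 2 ≤ u.val → u < v → u.val / 2 = v.val / 2 →
    χ a u v = ε (u.val / 2)
  right : ∀ {b u v : Fin n}, b.val = 1 → 2 ≤ u.val → u < v → χ b u v = -1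
  twin : ∀ {u v w : Fin n}, 2 ≤ u.val → u < v → v < w → u.val / 2 = v.val / 2 → χ u v w = 1
  level : ∀ {u v w : Fin n}, 2 ≤ u.val → u.val / 2 < v.val / 2 → v < w → χ u v w = -1

section Ladder

variable {n : ℕ} {χ ψ : Chirotope n} {s : SignType} {ε : ℕ → SignType}

/-- Label `1` and three points at three different levels are in convex position, so their
orientations are forced. -/
theorem IsLadder.right_of_level (h : IsLadder χ s ε) (hψ : IsAlternating ψ)
    (hR : SameRadial χ ψ) (hn : 8 ≤ n) {b u v : Fin n} (hb : b.val = 1) (hu : 2 ≤ u.val)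
    (huv : u.val / 2 < v.val / 2) : ψ b u v = -1 := by
  have key : ∀ {u v w : Fin n}, 2 ≤ u.val → u.val / 2 < v.val / 2 → v < w →
      ψ b u v = -1 ∧ ψ b u w = -1 ∧ ψ b v w = -1 := by
    intro u v w hu huv hvw
    have := hR.convex_neg h.alt hψ (h.right hb hu (by omega : u < v))
      (h.right hb hu (by omega : u < w)) (h.right hb (by omega) hvw) (h.level hu huv hvw)
    exact ⟨this.1, this.2.1, this.2.2.1⟩
  -- Since `8 ≤ n`, levels 1, 2 and 3 all occur, and one of them differs from the levels of `u` and
  -- `v`.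
  obtain ⟨w, hw, hwu, hwv⟩ : ∃ w : Fin n, 2 ≤ w.val ∧ w.val / 2 ≠ u.val / 2 ∧
      w.val / 2 ≠ v.val / 2 := by
    by_cases h1 : 1 ≠ u.val / 2 ∧ 1 ≠ v.val / 2
    · exact ⟨⟨2, by omega⟩, by simp, by simpa using h1⟩
    by_cases h2 : 2 ≠ u.val / 2 ∧ 2 ≠ v.val / 2
    · exact ⟨⟨4, by omega⟩, by simp, by simpa using h2⟩
    · exact ⟨⟨6, by omega⟩, by simp, by simp; omega⟩
  rcases lt_or_gt_of_ne hwu with h1 | h1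
  · exact (key hw h1 (by omega)).2.2
  rcases lt_or_gt_of_ne hwv with h2 | h2
  · exact (key hu h1 (by omega)).2.1
  · exact (key hu huv (by omega : v < w)).1

/-- For twins `u, v`, the point `v` lies inside the triangle `b w u`, whose orientation comes from
`IsLadder.right_of_level`. For different levels, `b, u, v, w` are in convex position. -/
theorem IsLadder.chain_eq (h : IsLadder χ s ε) (hψ : IsAlternating ψ)
    (hR : SameRadial χ ψ) (hn : 8 ≤ n) {b u v w : Fin n} (hb : b.val = 1) (hu : 2 ≤ u.val)
    (huv : u < v) (hvw : v < w) : ψ u v w = χ u v w ∧ ψ b u v = -1 := by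
  by_cases hl : u.val / 2 = v.val / 2
  · have h5 := h.right_of_level hψ hR hn hb hu (by omega : u.val / 2 < w.val / 2)
    obtain ⟨-, g2, g3⟩ := hR.inner h.alt hψ (a := b) (b := w) (c := u) (d := v)
      (by rw [h.alt.rev, h.right hb hu (huv.trans hvw), neg_neg])
      (by rw [h.alt.rev, h.right hb (by omega) hvw, neg_neg])
      (by rw [h.alt.rot v, h.alt.rot u, h.twin hu huv hvw hl])
      (by rw [h.alt.swap, h.right hb hu huv, neg_neg])
      (by rw [hψ.rev, h5, neg_neg])
    rw [hψ.rot v, hψ.rot u] at g2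
    rw [hψ.swap] at g3
    exact ⟨by rw [g2, h.twin hu huv hvw hl], neg_eq_iff_eq_neg.1 g3⟩
  · have hl' : u.val / 2 < v.val / 2 := by omega
    have := hR.convex_neg h.alt hψ (h.right hb hu huv)
      (h.right hb hu (huv.trans hvw)) (h.right hb (by omega) hvw) (h.level hu hl' hvw)
    exact ⟨by rw [this.2.2.2, h.level hu hl' hvw], this.1⟩

theorem IsLadder.right_eq (h : IsLadder χ s ε) (hψ : IsAlternating ψ)
    (hR : SameRadial χ ψ) (hn : 8 ≤ n) {b u v : Fin n} (hb : b.val = 1) (hu : 2 ≤ u.val)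
    (huv : u < v) : ψ b u v = -1 := by
  by_cases hl : u.val / 2 = v.val / 2
  · by_cases h2 : u.val / 2 = 1
    · exact (h.chain_eq hψ hR hn hb hu huv
        (show v < ⟨4, by omega⟩ from Fin.lt_def.2 (by simp; omega))).2
    · have hw : (⟨2, by omega⟩ : Fin n).val / 2 < u.val / 2 := by simp; omega
      have := hR.convex_neg h.alt hψ (h.right hb (by simp) (by omega)) (h.right hb (by simp)
        (by omega)) (h.right hb (by omega) huv) (h.level (by simp) hw huv)
      exact this.2.2.1
  · exact h.right_of_level hψ hR hn hb hu (by omega)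

/-- If `0` lies to the left of the twin line, then `0`, the twins and any higher point are in convex
position. -/
theorem IsLadder.left_of_level_ne (h : IsLadder χ s ε) (hψ : IsAlternating ψ)
    (hR : SameRadial χ ψ) {a u v w : Fin n} (ha : a.val = 0) (hu : 2 ≤ u.val) (huv : u < v)
    (hl : u.val / 2 = v.val / 2) (hvw : v < w) (hε : ε (u.val / 2) = 1) :
    ψ a u v = 1 ∧ ψ a u w = 1 ∧ ψ a v w = 1 := by
  have := hR.convex h.alt hψ (by rw [h.left_twin ha hu huv hl, hε])
    (h.left_level ha hu (by omega)) (h.left_level ha (by omega) (by omega)) (h.twin hu huv hvw hl)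
  exact ⟨this.1, this.2.1, this.2.2.1⟩

/-- The point `u` lies inside the triangle `a x v`, so the orientation of that triangle carries
over. -/
theorem IsLadder.left_of_lower (h : IsLadder χ s ε) (hψ : IsAlternating ψ)
    (hR : SameRadial χ ψ) {a x u v : Fin n} (ha : a.val = 0) (hx : 2 ≤ x.val)
    (hxu : x.val / 2 < u.val / 2) (huv : u < v) (h1 : χ a u v = 1) (h2 : ψ a x v = 1) :
    ψ a u v = 1 := by
  have := hR.inner h.alt hψ (a := a) (b := x) (c := v) (d := u)
    (h.left_level ha hx (by omega)) (h.left_level ha hx hxu)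
    (by rw [h.alt.rev, h.level hx hxu huv, neg_neg])
    (by rw [h.alt.rot u, h.alt.rot a, h1]) h2
  rw [← this.2.2, hψ.rot u, hψ.rot a]

/-- A ladder in which the connecting line of one pair of twins separates `0` from the base is
determined by its radial system. -/
theorem IsLadder.unique (hn : 8 ≤ n) {m : ℕ} (hm : 2 ≤ m) (hmn : 2 * m + 1 < n)
    (h : IsLadder χ 1 fun l => if l = m then -1 else 1) (hψ : IsAlternating ψ)
    (hac : IsAcyclic ψ) (hR : SameRadial χ ψ) : ψ = χ := by
  set ε : ℕ → SignType := fun l => if l = m then -1 else 1 with hε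
  have hε1 : ∀ l, l ≠ m → ε l = 1 := fun l hl => if_neg hl
  obtain ⟨a, ha⟩ : ∃ a : Fin n, a.val = 0 := ⟨⟨0, by omega⟩, rfl⟩
  obtain ⟨b, hb⟩ : ∃ b : Fin n, b.val = 1 := ⟨⟨1, by omega⟩, rfl⟩
  obtain ⟨x, hx⟩ : ∃ x : Fin n, x.val = 2 := ⟨⟨2, by omega⟩, rfl⟩
  obtain ⟨x', hx'⟩ : ∃ x : Fin n, x.val = 3 := ⟨⟨3, by omega⟩, rfl⟩
  obtain ⟨x4, hx4⟩ : ∃ x : Fin n, x.val = 4 := ⟨⟨4, by omega⟩, rfl⟩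
  obtain ⟨y, hy⟩ : ∃ y : Fin n, y.val = 2 * m := ⟨⟨2 * m, by omega⟩, rfl⟩
  obtain ⟨z, hz⟩ : ∃ z : Fin n, z.val = 2 * m + 1 := ⟨⟨2 * m + 1, by omega⟩, rfl⟩
  have hyz : y < z := by omega
  have hayz : χ a y z = -1 := by
    rw [h.left_twin ha (by omega) hyz (by omega)]
    exact if_pos (by omega)
  -- The tilted twin line makes `a, b, z, y` convex; this fixes the side of the line `a b` on which
  -- `y` and `z` lie.
  obtain ⟨g1, g2, g3, -⟩ := hR.convex h.alt hψ (a := a) (b := b) (c := z) (d := y)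
    (h.base ha hb (by omega)) (h.base ha hb (by omega)) (by rw [h.alt.rev, hayz, neg_neg])
    (by rw [h.alt.rev, h.right hb (by omega) hyz, neg_neg])
  -- Level 1 is untilted because `2 ≤ m`, so it serves as the lower reference level.
  have hx_left : ∀ v : Fin n, 4 ≤ v.val → ψ a x v = 1 := fun v hv =>
    (h.left_of_level_ne hψ hR ha (by omega) (by omega : x < x') (by omega) (by omega : x' < v)
      (hε1 _ (by omega))).2.1
  have left_level : ∀ u v : Fin n, 2 ≤ u.val → u.val / 2 < v.val / 2 → ψ a u v = 1 := by
    intro u v hu huv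
    by_cases h1 : u.val / 2 = m
    · exact h.left_of_lower hψ hR ha (by omega) (by omega) (by omega) (h.left_level ha hu huv)
        (hx_left v (by omega))
    · obtain ⟨lo, hlo⟩ : ∃ lo : Fin n, lo.val = 2 * (u.val / 2) := ⟨⟨_, by omega⟩, rfl⟩
      obtain ⟨hi, hhi⟩ : ∃ hi : Fin n, hi.val = 2 * (u.val / 2) + 1 := ⟨⟨_, by omega⟩, rfl⟩
      have := h.left_of_level_ne hψ hR ha (by omega) (by omega : lo < hi) (by omega)
        (by omega : hi < v) (hε1 _ (by omega))
      rcases Nat.mod_two_eq_zero_or_one u.val with h2 | h2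
      · rw [show u = lo from Fin.ext (by omega)]; exact this.2.1
      · rw [show u = hi from Fin.ext (by omega)]; exact this.2.2
  have left_twin : ∀ u v : Fin n, 2 ≤ u.val → u < v → u.val / 2 = v.val / 2 →
      ψ a u v = χ a u v := by
    intro u v hu huv hl
    by_cases h1 : u.val / 2 = m
    · rw [show u = y from Fin.ext (by omega), show v = z from Fin.ext (by omega), hayz]
      rw [hψ.rev] at g3
      exact neg_eq_iff_eq_neg.1 g3
    · have h2 : χ a u v = 1 := by rw [h.left_twin ha hu huv hl, hε1 _ h1]
      rw [h2]
      by_cases h3 : u.val / 2 = 1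
      · exact (h.left_of_level_ne hψ hR ha hu huv hl (by omega : v < x4) (hε1 _ h1)).1
      · exact h.left_of_lower hψ hR ha (by omega) (by omega) huv h2 (hx_left v (by omega))
  have right := fun {u v : Fin n} => h.right_eq hψ hR hn (u := u) (v := v) hb
  have base : ∀ u : Fin n, 2 ≤ u.val → ψ a b u = 1 := by
    intro u hu
    rcases lt_trichotomy (u.val / 2) m with h1 | h1 | h1
    · exact (hR.inner h.alt hψ (a := a) (b := b) (c := y) (d := u) (h.base ha hb (by omega))
        (h.base ha hb hu) (by rw [h.alt.rev, h.right hb hu (by omega), neg_neg])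
        (by rw [h.alt.rot u, h.alt.rot a, h.left_level ha hu (by omega)]) g2).1
    · rcases Nat.mod_two_eq_zero_or_one u.val with h2 | h2
      · rw [show u = y from Fin.ext (by omega)]; exact g2
      · rw [show u = z from Fin.ext (by omega)]; exact g1
    · refine hac a b u y g2 ?_ ?_ (by omega) (by omega) (by omega)
      · rw [hψ.rev, right (by omega) (by omega), neg_neg]
      · rw [hψ.rot y, hψ.rot a, left_level y u (by omega) (by omega)]
  funext i j k
  refine (hψ.eq_of_sorted h.alt (Q := fun _ _ _ => False) (fun _ _ _ => id) (fun _ _ _ => id)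
    (fun i j k hij hjk => Or.inr ?_) i j k).resolve_left id
  by_cases hi0 : i.val = 0
  · obtain rfl : i = a := Fin.ext (by omega)
    by_cases hj1 : j.val = 1
    · obtain rfl : j = b := Fin.ext (by omega)
      rw [base k (by omega), h.base ha hb (by omega)]
    · by_cases hl : j.val / 2 = k.val / 2
      · exact left_twin j k (by omega) hjk hl
      · rw [left_level j k (by omega) (by omega), h.left_level ha (by omega) (by omega)]
  by_cases hi1 : i.val = 1
  · obtain rfl : i = b := Fin.ext (by omega)
    rw [right (by omega) hjk, h.right hb (by omega) hjk]
  · exact (h.chain_eq hψ hR hn hb (by omega) hij hjk).1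

/-- Ladders that differ at one level only. -/
theorem IsLadder.agreeOff {ε' : ℕ → SignType} (h : IsLadder χ s ε) (h' : IsLadder ψ s ε')
    {m : ℕ} (hε : ∀ l, l ≠ m → ε l = ε' l) {y z : Fin n} (hy : y.val = 2 * m)
    (hz : z.val = 2 * m + 1) : AgreeOff χ ψ y z := by
  refine h.alt.eq_of_sorted h'.alt ?_ ?_ ?_
  · intro i j k; tauto
  · intro i j k; tauto
  intro i j k hij hjk
  by_cases hi0 : i.val = 0
  · by_cases hj1 : j.val = 1
    · right; rw [h.base hi0 hj1 (by omega), h'.base hi0 hj1 (by omega)]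
    · by_cases hl : j.val / 2 = k.val / 2
      · by_cases hm : j.val / 2 = m
        · left
          exact ⟨Or.inr (Or.inl (Fin.ext (by omega))), Or.inr (Or.inr (Fin.ext (by omega)))⟩
        · right
          rw [h.left_twin hi0 (by omega) hjk hl, h'.left_twin hi0 (by omega) hjk hl, hε _ hm]
      · right
        rw [h.left_level hi0 (by omega) (by omega), h'.left_level hi0 (by omega) (by omega)]
  right
  by_cases hi1 : i.val = 1
  · rw [h.right hi1 (by omega) hjk, h'.right hi1 (by omega) hjk]
  by_cases hl : i.val / 2 = j.val / 2
  · rw [h.twin (by omega) hij hjk hl, h'.twin (by omega) hij hjk hl]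
  · rw [h.level (by omega) (by omega) hjk, h'.level (by omega) (by omega) hjk]

end Ladder

/-! ### Counting order types -/

section Counting

variable {n : ℕ} {χ ψ : Chirotope n}

/-- For `s = 1` the point `u` is inside the triangle `a b v`; for `s = -1` the point `v` is inside
`a b u`. In each rotation the triples containing `a` and `b` cancel or are outvoted, so `s` drops
out. -/
theorem IsLadder.ccwAround {s : SignType} (h : IsLadder χ s fun _ => 1) (hs : s ≠ 0)
    {a b u v : Fin n} (ha : a.val = 0) (hb : b.val = 1) (hu : 2 ≤ u.val) (huv : u < v) :
    CcwAround χ a b u v ∧ ¬ CcwAround χ b a u v ∧ CcwAround χ u a b v ∧ ¬ CcwAround χ v a b u := by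
  have hA := h.alt
  have h1 : χ a b u = s := h.base ha hb hu
  have h2 : χ a b v = s := h.base ha hb (by omega)
  have h3 : χ b u v = -1 := h.right hb hu huv
  have h4 : χ a u v = 1 := by
    by_cases hl : u.val / 2 = v.val / 2
    · exact h.left_twin ha hu huv hl
    · exact h.left_level ha hu (by omega)
  have e1 : χ a v b = -s := by rw [hA.rev, h2]
  have e2 : χ b a u = -s := by rw [hA.swap, h1]
  have e3 : χ b v a = s := by rw [hA.rot, h2]
  have e4 : χ u a b = s := by rw [hA.rot b, hA.rot a, h1]
  have e5 : χ u b v = 1 := by rw [hA.swap, h3, neg_neg]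
  have e6 : χ u v a = 1 := by rw [hA.rot, h4]
  have e7 : χ v a b = s := by rw [hA.rot b, hA.rot a, h2]
  have e8 : χ v b u = -1 := by rw [hA.rot u, hA.rot b, h3]
  have e9 : χ v u a = -1 := by rw [hA.rot a, hA.rev, h4]
  simp only [CcwAround, h1, h3, h4, e1, e2, e3, e4, e5, e6, e7, e8, e9]
  clear * - hs
  revert s; decide

/-- Turning the line through `0` and `1` over does not change the radial system. -/
theorem IsLadder.sameRadial {s s' : SignType} (h : IsLadder χ s fun _ => 1)
    (h' : IsLadder ψ s' fun _ => 1) (hs : s ≠ 0) (hs' : s' ≠ 0) (hn : 2 ≤ n) :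
    SameRadial χ ψ := by
  obtain ⟨a, ha⟩ : ∃ a : Fin n, a.val = 0 := ⟨⟨0, by omega⟩, rfl⟩
  obtain ⟨b, hb⟩ : ∃ b : Fin n, b.val = 1 := ⟨⟨1, by omega⟩, rfl⟩
  have hab : a ≠ b := by omega
  have agree : AgreeOff χ ψ a b := by
    refine h.alt.eq_of_sorted h'.alt ?_ ?_ ?_
    · intro i j k; tauto
    · intro i j k; tauto
    intro i j k hij hjk
    by_cases hi0 : i.val = 0
    · by_cases hj1 : j.val = 1
      · left
        exact ⟨Or.inl (Fin.ext (by omega)), Or.inr (Or.inl (Fin.ext (by omega)))⟩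
      · right
        by_cases hl : j.val / 2 = k.val / 2
        · rw [h.left_twin hi0 (by omega) hjk hl, h'.left_twin hi0 (by omega) hjk hl]
        · rw [h.left_level hi0 (by omega) (by omega), h'.left_level hi0 (by omega) (by omega)]
    right
    by_cases hi1 : i.val = 1
    · rw [h.right hi1 (by omega) hjk, h'.right hi1 (by omega) hjk]
    by_cases hl : i.val / 2 = j.val / 2
    · rw [h.twin (by omega) hij hjk hl, h'.twin (by omega) hij hjk hl]
    · rw [h.level (by omega) (by omega) hjk, h'.level (by omega) (by omega) hjk]
  have rot : ∀ {i j k l}, (CcwAround χ i j k l ↔ CcwAround ψ i j k l) →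
      (CcwAround χ i k l j ↔ CcwAround ψ i k l j) := fun {i j k l} e =>
    ⟨fun hc => (e.1 hc.rot.rot).rot, fun hc => (e.2 hc.rot.rot).rot⟩
  have rev : ∀ {i j k l}, j ≠ i → k ≠ i → l ≠ i → Distinct3 j k l →
      (CcwAround χ i j k l ↔ CcwAround ψ i j k l) →
      (CcwAround χ i j l k ↔ CcwAround ψ i j l k) := by
    intro i j k l hj hk hl hd e
    rw [h.alt.ccwAround_rev hj hk hl hd, h'.alt.ccwAround_rev hj hk hl hd, e]
  have chain : ∀ {u : Fin n}, u ≠ a → u ≠ b → 2 ≤ u.val := by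
    intro u h1 h2; omega
  -- Only rotations of quadruples containing both `a` and `b` can be affected by `s`; the others
  -- compare equal triples.
  have main : ∀ {u v : Fin n}, u ≠ a → u ≠ b → v ≠ a → v ≠ b → u ≠ v →
      (CcwAround χ a b u v ↔ CcwAround ψ a b u v) ∧ (CcwAround χ b a u v ↔ CcwAround ψ b a u v) ∧
      (CcwAround χ u a b v ↔ CcwAround ψ u a b v) := by
    intro u v hua hub hva hvb huv
    rcases huv.lt_or_gt with hlt | hlt
    · obtain ⟨g1, g2, g3, -⟩ := h.ccwAround hs ha hb (chain hua hub) hlt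
      obtain ⟨k1, k2, k3, -⟩ := h'.ccwAround hs' ha hb (chain hua hub) hlt
      exact ⟨iff_of_true g1 k1, iff_of_false g2 k2, iff_of_true g3 k3⟩
    · obtain ⟨g1, g2, -, g3⟩ := h.ccwAround hs ha hb (chain hva hvb) hlt
      obtain ⟨k1, k2, -, k3⟩ := h'.ccwAround hs' ha hb (chain hva hvb) hlt
      exact ⟨rev hab.symm hva hua ⟨hvb.symm, hub.symm, huv.symm⟩ (iff_of_true g1 k1),
        rev hab hvb hub ⟨hva.symm, hua.symm, huv.symm⟩ (iff_of_false g2 k2), iff_of_false g3 k3⟩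
  intro i j k l hj hk hl hd
  obtain ⟨hjk, hjl, hkl⟩ := hd
  by_cases hi : i = a
  · subst hi
    by_cases hjb : j = b
    · subst hjb; exact (main hk hjk.symm hl hjl.symm hkl).1
    by_cases hkb : k = b
    · subst hkb; exact rot (rot (main hl hkl.symm hj hjk hjl.symm).1)
    by_cases hlb : l = b
    · subst hlb; exact rot (main hj hjl hk hkl hjk).1
    · rw [CcwAround, CcwAround, (agree i j k).resolve_left (by grind),
        (agree i k l).resolve_left (by grind), (agree i l j).resolve_left (by grind)]
  by_cases hi' : i = b
  · subst hi'
    by_cases hja : j = a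
    · subst hja; exact (main hjk.symm hk hjl.symm hl hkl).2.1
    by_cases hka : k = a
    · subst hka; exact rot (rot (main hkl.symm hl hjk hj hjl.symm).2.1)
    by_cases hla : l = a
    · subst hla; exact rot (main hjl hj hkl hk hjk).2.1
    · rw [CcwAround, CcwAround, (agree i j k).resolve_left (by grind),
        (agree i k l).resolve_left (by grind), (agree i l j).resolve_left (by grind)]
  have third : ∀ {v}, v ≠ a → v ≠ b → v ≠ i →
      (CcwAround χ i a b v ↔ CcwAround ψ i a b v) ∧ (CcwAround χ i a v b ↔ CcwAround ψ i a v b) := by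
    intro v hva hvb hvi
    have := (main hi hi' hva hvb hvi.symm).2.2
    exact ⟨this, rev (Ne.symm hi) (Ne.symm hi') hvi ⟨hab, hva.symm, hvb.symm⟩ this⟩
  by_cases hja : j = a
  · subst hja
    by_cases hkb : k = b
    · subst hkb; exact (third hjl.symm hkl.symm hl).1
    by_cases hlb : l = b
    · subst hlb; exact (third hjk.symm hkb hk).2
    · rw [CcwAround, CcwAround, (agree i j k).resolve_left (by grind),
        (agree i k l).resolve_left (by grind), (agree i l j).resolve_left (by grind)]
  by_cases hka : k = a
  · subst hka
    by_cases hjb : j = b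
    · subst hjb; exact rot (rot (third hkl.symm hjl.symm hl).2)
    by_cases hlb : l = b
    · subst hlb; exact rot (rot (third hja hjb hj).1)
    · rw [CcwAround, CcwAround, (agree i j k).resolve_left (by grind),
        (agree i k l).resolve_left (by grind), (agree i l j).resolve_left (by grind)]
  by_cases hla : l = a
  · subst hla
    by_cases hjb : j = b
    · subst hjb; exact rot (third hka hjk.symm hk).1
    by_cases hkb : k = b
    · subst hkb; exact rot (third hja hjb hj).2
    · rw [CcwAround, CcwAround, (agree i j k).resolve_left (by grind),
        (agree i k l).resolve_left (by grind), (agree i l j).resolve_left (by grind)]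
  · rw [CcwAround, CcwAround, (agree i j k).resolve_left (by grind),
      (agree i k l).resolve_left (by grind), (agree i l j).resolve_left (by grind)]

theorem IsLadder.one_lt_ncard (h : IsLadder χ 1 fun _ => 1) (h' : IsLadder ψ (-1) fun _ => 1)
    (hn : 8 ≤ n) (hχ : IsAbstractChirotope χ) (hψ : IsAbstractChirotope ψ) {R : RotationSystem n}
    (hR : IsRadialSystemOf χ R) : 1 < (T R).ncard := by
  rw [Set.one_lt_ncard (Set.toFinite _)]
  refine ⟨_, ⟨χ, hχ, hR, rfl⟩, _, ⟨ψ, hψ, ?_, rfl⟩, fun e => ?_⟩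
  · exact (h.sameRadial h' (by decide) (by decide) (by omega)).isRadialSystemOf hR
  obtain ⟨a, ha⟩ : ∃ a : Fin n, a.val = 0 := ⟨⟨0, by omega⟩, rfl⟩
  obtain ⟨b, hb⟩ : ∃ b : Fin n, b.val = 1 := ⟨⟨1, by omega⟩, rfl⟩
  obtain ⟨u, hu⟩ : ∃ u : Fin n, u.val = 2 := ⟨⟨2, by omega⟩, rfl⟩
  obtain ⟨v, hv⟩ : ∃ v : Fin n, v.val = 4 := ⟨⟨4, by omega⟩, rfl⟩
  rcases Quotient.exact e with e | e
  -- The ladders differ on `a, b, u` but agree on `a, u, v`, so they are neither equal nor negatives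
  -- of each other.
  · have := e a b u
    rw [h.base ha hb (by omega), h'.base ha hb (by omega)] at this
    exact absurd this (by decide)
  · have := e a u v
    rw [h.left_level ha (by omega) (by omega), h'.left_level ha (by omega) (by omega)] at this
    exact absurd this (by decide)

theorem IsLadder.ncard_le_one (hn : 8 ≤ n) {m : ℕ} (hm : 2 ≤ m) (hmn : 2 * m + 1 < n)
    (h : IsLadder χ 1 fun l => if l = m then -1 else 1) {R : RotationSystem n}
    (hR : IsRadialSystemOf χ R) : (T R).ncard ≤ 1 := by
  have key : ∀ τ ∈ T R, τ = Quotient.mk (chirotopeSetoid n) χ := by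
    rintro τ ⟨ψ, ⟨C, hC⟩, hψR, rfl⟩
    rw [h.unique hn hm hmn hC.isAlternating hC.isAcyclic (hR.sameRadial hψR)]
  rw [Set.ncard_le_one (Set.toFinite _)]
  intro a ha b hb
  rw [key a ha, key b hb]

end Counting

/-! ### Realization of ladders -/

section Realization

variable {n : ℕ}

theorem generalPosition_of_sorted (hn : 3 ≤ n) {p : Fin n → ℝ × ℝ}
    (h : ∀ i j k, i < j → j < k → pointChirotope p i j k ≠ 0) : GeneralPosition p := by
  simp only [pointChirotope_eq, sign_ne_zero] at h
  have key : ∀ i j k, Distinct3 i j k → area (p i) (p j) (p k) ≠ 0 := by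
    intro i j k ⟨hij, hik, hjk⟩
    rcases hij.lt_or_gt with h1 | h1 <;> rcases hik.lt_or_gt with h2 | h2 <;>
      rcases hjk.lt_or_gt with h3 | h3
    · exact h _ _ _ h1 h3
    · rw [area_rot, area_rot, ← neg_ne_zero, ← area_swap, area_rot]; exact h _ _ _ h2 h3
    · exact absurd (h1.trans (h3.trans h2)) (lt_irrefl _)
    · rw [area_rot]; exact h _ _ _ h2 h1
    · rw [area_swap, neg_ne_zero]; exact h _ _ _ h1 h2
    · exact absurd (h1.trans (h2.trans h3)) (lt_irrefl _)
    · rw [← area_rot]; exact h _ _ _ h3 h2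
    · rw [area_swap, neg_ne_zero, area_rot]; exact h _ _ _ h3 h1
  refine ⟨fun i j hij => ?_, fun i j k hd => ?_⟩
  · by_contra hne
    obtain ⟨k, hk⟩ : ∃ k : Fin n, k ∉ ({i, j} : Finset (Fin n)) := by
      by_contra hall
      push Not at hall
      have h1 : (Finset.univ : Finset (Fin n)).card ≤ _ :=
        Finset.card_le_card fun k _ => hall k
      have h2 := Finset.card_le_two (a := i) (b := j)
      rw [Finset.card_univ, Fintype.card_fin] at h1
      omega
    simp only [Finset.mem_insert, Finset.mem_singleton, not_or] at hk
    refine key i j k ⟨hne, Ne.symm hk.1, Ne.symm hk.2⟩ ?_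
    rw [area, hij]; ring
  · rw [pointChirotope_eq, sign_ne_zero]
    exact key i j k hd

theorem eventually_sign {f : ℝ → ℝ} (hf : Continuous f) {σ : SignType}
    (h : SignType.sign (f 0) = σ) (hσ : σ ≠ 0) :
    ∀ᶠ e in 𝓝[>] (0 : ℝ), SignType.sign (f e) = σ := by
  rw [← h]
  exact eventually_sign_eq hf (by rwa [← sign_ne_zero, h])

/-- Triples containing twins degenerate at `e = 0`; after dividing by `e`, their sign is read off
the limit. -/
theorem eventually_sign_mul {f g : ℝ → ℝ} (hg : Continuous g) (hfg : ∀ e, f e = e * g e)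
    {σ : SignType} (h : SignType.sign (g 0) = σ) (hσ : σ ≠ 0) :
    ∀ᶠ e in 𝓝[>] (0 : ℝ), SignType.sign (f e) = σ := by
  filter_upwards [eventually_sign hg h hσ, self_mem_nhdsWithin] with e he hpos
  rw [hfg, sign_mul, sign_pos hpos, one_mul, he]

/-- The point of a parabola that carries the points at level `h`. -/
def levelPoint (h : ℕ) : ℝ × ℝ := ((h : ℝ) ^ 2, (h : ℝ))

/-- The determinant of two vectors. -/
def vecDet (d v : ℝ × ℝ) : ℝ := d.1 * v.2 - d.2 * v.1

/-- The points of a ladder: `a`, `b`, and at each level two points at distance of order `e` in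
direction `d`. -/
noncomputable def ladderPoints (a b : ℝ × ℝ) (d : ℕ → ℝ × ℝ) (e : ℝ) (i : Fin n) : ℝ × ℝ :=
  if i.val = 0 then a else if i.val = 1 then b else
    levelPoint (i.val / 2) + (e * (i.val % 2 : ℕ)) • d (i.val / 2)

variable {a b : ℝ × ℝ} {d : ℕ → ℝ × ℝ}

theorem ladderPoints_zero {e : ℝ} {i : Fin n} (hi : i.val = 0) :
    ladderPoints a b d e i = a := if_pos hi

theorem ladderPoints_one {e : ℝ} {i : Fin n} (hi : i.val = 1) :
    ladderPoints a b d e i = b := by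
  rw [ladderPoints, if_neg (by omega), if_pos hi]

theorem ladderPoints_chain {e : ℝ} {i : Fin n} (hi : 2 ≤ i.val) :
    ladderPoints a b d e i = levelPoint (i.val / 2) + (e * (i.val % 2 : ℕ)) • d (i.val / 2) := by
  rw [ladderPoints, if_neg (by omega), if_neg (by omega)]

theorem ladderPoints_even {e : ℝ} {i : Fin n} (hi : 2 ≤ i.val) (h : i.val % 2 = 0) :
    ladderPoints a b d e i = levelPoint (i.val / 2) := by
  rw [ladderPoints_chain hi, h]; simp

theorem ladderPoints_odd {e : ℝ} {i : Fin n} (hi : 2 ≤ i.val) (h : i.val % 2 = 1) :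
    ladderPoints a b d e i = levelPoint (i.val / 2) + e • d (i.val / 2) := by
  rw [ladderPoints_chain hi, h]; simp

theorem ladderPoints_at_zero {i : Fin n} (hi : 2 ≤ i.val) :
    ladderPoints a b d 0 i = levelPoint (i.val / 2) := by
  rw [ladderPoints_chain hi]; simp

theorem continuous_ladderPoints (i : Fin n) : Continuous fun e => ladderPoints a b d e i := by
  unfold ladderPoints
  split_ifs <;> fun_prop

theorem continuous_area {p q r : ℝ → ℝ × ℝ} (hp : Continuous p) (hq : Continuous q)
    (hr : Continuous r) : Continuous fun e => area (p e) (q e) (r e) := by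
  unfold area; fun_prop

theorem area_twin (p q v : ℝ × ℝ) (e : ℝ) : area p q (q + e • v) = e * vecDet v (p - q) := by
  simp only [area, vecDet, Prod.fst_add, Prod.snd_add, Prod.smul_fst, Prod.smul_snd, smul_eq_mul,
    Prod.fst_sub, Prod.snd_sub]
  ring

/-- The chord of the parabola between levels `h` and `g` is `g - h` times `(g + h, 1)`; the
hypothesis puts `d` clockwise from the latter. -/
theorem sign_vecDet_levelPoint {d : ℝ × ℝ} {g h : ℕ} (hd : d.2 * ((g : ℝ) + h) < d.1) :
    SignType.sign (vecDet d (levelPoint g - levelPoint h)) = SignType.sign ((g : ℝ) - h) := by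
  rw [show vecDet d (levelPoint g - levelPoint h) = (d.1 - d.2 * ((g : ℝ) + h)) * ((g : ℝ) - h) by
    simp only [vecDet, levelPoint, Prod.fst_sub, Prod.snd_sub]; ring, sign_mul,
    sign_pos (sub_pos.2 hd), one_mul]

/-- For small `e > 0`, triples without twins keep their limit orientation, and triples with twins
are decided by the direction `d`. Finitely many open conditions then suffice. -/
theorem exists_ladder (hn : 3 ≤ n) {s : SignType} {ε : ℕ → SignType} (hs : s ≠ 0)
    (hε : ∀ h, ε h ≠ 0)
    (base : ∀ h, 1 ≤ h → h < n → SignType.sign (area a b (levelPoint h)) = s)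
    (left : ∀ g h, 1 ≤ g → g < h → h < n → 0 < area a (levelPoint g) (levelPoint h))
    (right : ∀ g h, 1 ≤ g → g < h → h < n → area b (levelPoint g) (levelPoint h) < 0)
    (left_twin : ∀ h, 1 ≤ h → h < n → SignType.sign (vecDet (d h) (a - levelPoint h)) = ε h)
    (right_twin : ∀ h, 1 ≤ h → h < n → vecDet (d h) (b - levelPoint h) < 0)
    (slope : ∀ g h, g < n → 1 ≤ h → h < n → (d h).2 * ((g : ℝ) + h) < (d h).1) :
    ∃ p : Fin n → ℝ × ℝ, GeneralPosition p ∧ IsLadder (pointChirotope p) s ε := by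
  let p : ℝ → Fin n → ℝ × ℝ := ladderPoints a b d
  have hcont : ∀ i j k : Fin n, Continuous fun e => area (p e i) (p e j) (p e k) := fun i j k =>
    continuous_area (continuous_ladderPoints i) (continuous_ladderPoints j)
      (continuous_ladderPoints k)
  have E1 : ∀ᶠ e in 𝓝[>] (0 : ℝ), ∀ x y u : Fin n, x.val = 0 → y.val = 1 → 2 ≤ u.val →
      pointChirotope (p e) x y u = s := by
    simp only [eventually_all]
    intro x y u hx hy hu
    refine eventually_sign (hcont x y u) ?_ hs
    simp only [p]
    rw [ladderPoints_zero hx, ladderPoints_one hy, ladderPoints_at_zero hu]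
    exact base _ (by omega) (by omega)
  have E2 : ∀ᶠ e in 𝓝[>] (0 : ℝ), ∀ x u v : Fin n, x.val = 0 → 2 ≤ u.val →
      u.val / 2 < v.val / 2 → pointChirotope (p e) x u v = 1 := by
    simp only [eventually_all]
    intro x u v hx hu huv
    refine eventually_sign (hcont x u v) ?_ (by decide)
    simp only [p]
    rw [ladderPoints_zero hx, ladderPoints_at_zero hu, ladderPoints_at_zero (by omega)]
    exact sign_pos (left _ _ (by omega) huv (by omega))
  have E3 : ∀ᶠ e in 𝓝[>] (0 : ℝ), ∀ x u v : Fin n, x.val = 0 → 2 ≤ u.val → u < v →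
      u.val / 2 = v.val / 2 → pointChirotope (p e) x u v = ε (u.val / 2) := by
    simp only [eventually_all]
    intro x u v hx hu huv hl
    refine eventually_sign_mul (g := fun _ => vecDet (d (u.val / 2)) (a - levelPoint (u.val / 2)))
      continuous_const (fun e => ?_) (left_twin _ (by omega) (by omega)) (hε _)
    simp only [p]
    rw [ladderPoints_zero hx, ladderPoints_even hu (by omega),
      ladderPoints_odd (by omega) (by omega), ← hl]
    exact area_twin _ _ _ _
  have E4 : ∀ᶠ e in 𝓝[>] (0 : ℝ), ∀ x u v : Fin n, x.val = 1 → 2 ≤ u.val → u < v →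
      pointChirotope (p e) x u v = -1 := by
    simp only [eventually_all]
    intro x u v hx hu huv
    by_cases hl : u.val / 2 = v.val / 2
    · refine eventually_sign_mul
        (g := fun _ => vecDet (d (u.val / 2)) (b - levelPoint (u.val / 2)))
        continuous_const (fun e => ?_) (sign_neg (right_twin _ (by omega) (by omega))) (by decide)
      simp only [p]
      rw [ladderPoints_one hx, ladderPoints_even hu (by omega),
        ladderPoints_odd (by omega) (by omega), ← hl]
      exact area_twin _ _ _ _
    · refine eventually_sign (hcont x u v) ?_ (by decide)
      simp only [p]
      rw [ladderPoints_one hx, ladderPoints_at_zero hu, ladderPoints_at_zero (by omega)]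
      exact sign_neg (right _ _ (by omega) (by omega) (by omega))
  have htwin : ∀ u v w : Fin n, 2 ≤ u.val → u < v → u.val / 2 = v.val / 2 → 2 ≤ w.val →
      w.val / 2 ≠ u.val / 2 → ∀ᶠ e in 𝓝[>] (0 : ℝ), SignType.sign (area (p e w) (p e u) (p e v)) =
        SignType.sign (((w.val / 2 : ℕ) : ℝ) - (u.val / 2 : ℕ)) := by
    intro u v w hu huv hl hw hne
    refine eventually_sign_mul
      (g := fun e => vecDet (d (u.val / 2)) (p e w - levelPoint (u.val / 2))) ?_ (fun e => ?_) ?_ ?_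
    · have := continuous_ladderPoints (a := a) (b := b) (d := d) w
      simp only [vecDet, p]
      fun_prop
    · simp only [p]
      rw [ladderPoints_even hu (by omega), ladderPoints_odd (i := v) (by omega) (by omega), ← hl,
        area_twin]
    · simp only [p]
      rw [ladderPoints_at_zero hw]
      exact sign_vecDet_levelPoint (slope _ _ (by omega) (by omega) (by omega))
    · rw [sign_ne_zero, sub_ne_zero]
      exact_mod_cast hne
  have E5 : ∀ᶠ e in 𝓝[>] (0 : ℝ), ∀ u v w : Fin n, 2 ≤ u.val → u < v → v < w →
      u.val / 2 = v.val / 2 → pointChirotope (p e) u v w = 1 := by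
    simp only [eventually_all]
    intro u v w hu huv hvw hl
    filter_upwards [htwin u v w hu huv hl (by omega) (by omega)] with e he
    rw [pointChirotope_eq, area_rot, he]
    apply sign_pos
    rw [sub_pos]
    exact_mod_cast (by omega : u.val / 2 < w.val / 2)
  have E6 : ∀ᶠ e in 𝓝[>] (0 : ℝ), ∀ u v w : Fin n, 2 ≤ u.val → u.val / 2 < v.val / 2 → v < w →
      pointChirotope (p e) u v w = -1 := by
    simp only [eventually_all]
    intro u v w hu huv hvw
    by_cases hl : v.val / 2 = w.val / 2
    · filter_upwards [htwin v w u (by omega) hvw hl hu (by omega)] with e he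
      rw [pointChirotope_eq, he]
      apply sign_neg
      rw [sub_neg]
      exact_mod_cast huv
    · refine eventually_sign (hcont u v w) ?_ (by decide)
      simp only [p]
      rw [ladderPoints_at_zero hu, ladderPoints_at_zero (by omega), ladderPoints_at_zero (by omega)]
      apply sign_neg
      have h1 : ((u.val / 2 : ℕ) : ℝ) < (v.val / 2 : ℕ) := by exact_mod_cast huv
      have h2 : ((v.val / 2 : ℕ) : ℝ) < (w.val / 2 : ℕ) := by
        exact_mod_cast (by omega : v.val / 2 < w.val / 2)
      rw [show area (levelPoint (u.val / 2)) (levelPoint (v.val / 2)) (levelPoint (w.val / 2)) =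
        (((v.val / 2 : ℕ) : ℝ) - (u.val / 2 : ℕ)) * (((w.val / 2 : ℕ) : ℝ) - (u.val / 2 : ℕ)) *
          (((v.val / 2 : ℕ) : ℝ) - (w.val / 2 : ℕ)) by simp only [area, levelPoint]; ring]
      exact mul_neg_of_pos_of_neg (mul_pos (by linarith) (by linarith)) (by linarith)
  obtain ⟨e, e1, e2, e3, e4, e5, e6⟩ :=
    (E1.and (E2.and (E3.and (E4.and (E5.and E6))))).exists
  have hp : GeneralPosition (p e) := by
    refine generalPosition_of_sorted hn fun i j k hij hjk => ?_
    by_cases hi0 : i.val = 0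
    · by_cases hj1 : j.val = 1
      · rw [e1 i j k hi0 hj1 (by omega)]; exact hs
      · by_cases hl : j.val / 2 = k.val / 2
        · rw [e3 i j k hi0 (by omega) hjk hl]; exact hε _
        · rw [e2 i j k hi0 (by omega) (by omega)]; decide
    by_cases hi1 : i.val = 1
    · rw [e4 i j k hi1 (by omega) hjk]; decide
    by_cases hl : i.val / 2 = j.val / 2
    · rw [e5 i j k (by omega) hij hjk hl]; decide
    · rw [e6 i j k (by omega) (by omega) hjk]; decide
  exact ⟨p e, hp, hp.isAlternating, e1 _ _ _, e2 _ _ _, e3 _ _ _, e4 _ _ _, e5 _ _ _, e6 _ _ _⟩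

/-- Ladders with the base line below can be realized with arbitrary twin orientations at `0`. -/
theorem exists_ladder_pos (hn : 3 ≤ n) {ε : ℕ → SignType} (hε : ∀ h, ε h ≠ 0) :
    ∃ p : Fin n → ℝ × ℝ, GeneralPosition p ∧ IsLadder (pointChirotope p) 1 ε := by
  have hn' : (3 : ℝ) ≤ n := by exact_mod_cast hn
  have abs_le : ∀ h, ((ε h : SignType) : ℝ) ≤ 1 := by
    intro h
    rcases SignType.eq_one_or_of_ne_zero (hε h) with e | e <;> rw [e] <;> norm_num
  have cast_lt : ∀ {h : ℕ}, h < n → (h : ℝ) + 1 ≤ n := fun h => by exact_mod_cast h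
  -- The direction `d h` is the vector from `a` to level `h`, tilted by `ε h` so that the twin line
  -- just misses `a` on the required side. The distance `10 * n ^ 2` makes these directions flatter
  -- than all chords.
  refine exists_ladder (a := (-(10 * (n : ℝ) ^ 2), -1)) (b := (1, -1))
    (d := fun h => ((h : ℝ) ^ 2 + 10 * (n : ℝ) ^ 2, (h : ℝ) + 1 + ((ε h : SignType) : ℝ)))
    hn (by decide) hε ?_ ?_ ?_ ?_ ?_ ?_
  · intro h _ _
    apply sign_pos
    simp only [area, levelPoint]
    have : (0 : ℝ) ≤ h := Nat.cast_nonneg h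
    nlinarith [mul_nonneg (sq_nonneg (n : ℝ)) this]
  · intro g h hg hgh hh
    have h0 : (1 : ℝ) ≤ g := by exact_mod_cast hg
    have h1 : (g : ℝ) < h := by exact_mod_cast hgh
    have h2 := cast_lt hh
    rw [show area (-(10 * (n : ℝ) ^ 2), -1) (levelPoint g) (levelPoint h) =
      ((h : ℝ) - g) * (10 * (n : ℝ) ^ 2 - g * h - (g + h)) by simp only [area, levelPoint]; ring]
    refine mul_pos (by linarith) ?_
    nlinarith
  · intro g h hg hgh hh
    have h0 : (1 : ℝ) ≤ g := by exact_mod_cast hg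
    have h1 : (g : ℝ) < h := by exact_mod_cast hgh
    rw [show area ((1 : ℝ), (-1 : ℝ)) (levelPoint g) (levelPoint h) =
      (((h : ℝ) + 1) * (g + 1)) * (g - h) by simp only [area, levelPoint]; ring]
    exact mul_neg_of_pos_of_neg (by positivity) (by linarith)
  · intro h _ _
    simp only [vecDet, levelPoint, Prod.mk_sub_mk]
    rw [show ((h : ℝ) ^ 2 + 10 * (n : ℝ) ^ 2) * (-1 - (h : ℝ)) -
        ((h : ℝ) + 1 + ((ε h : SignType) : ℝ)) * (-(10 * (n : ℝ) ^ 2) - (h : ℝ) ^ 2) =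
      ((h : ℝ) ^ 2 + 10 * (n : ℝ) ^ 2) * ((ε h : SignType) : ℝ) by ring, sign_mul,
      sign_pos (by positivity), one_mul]
    rcases SignType.eq_one_or_of_ne_zero (hε h) with e | e <;> rw [e] <;> simp
  · intro h h0 hh
    have h0 : (1 : ℝ) ≤ h := by exact_mod_cast h0
    have h2 := cast_lt hh
    have h3 := abs_le h
    simp only [vecDet, levelPoint, Prod.mk_sub_mk]
    rw [show ((h : ℝ) ^ 2 + 10 * (n : ℝ) ^ 2) * (-1 - (h : ℝ)) -
        ((h : ℝ) + 1 + ((ε h : SignType) : ℝ)) * (1 - (h : ℝ) ^ 2) =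
      ((h : ℝ) + 1) * (((ε h : SignType) : ℝ) * (h - 1) - (10 * (n : ℝ) ^ 2 + 1)) by ring]
    refine mul_neg_of_pos_of_neg (by positivity) ?_
    nlinarith
  · intro g h hg h0 hh
    have h0 : (1 : ℝ) ≤ h := by exact_mod_cast h0
    have hg0 : (0 : ℝ) ≤ g := Nat.cast_nonneg g
    have h1 := cast_lt hg
    have h2 := cast_lt hh
    have h3 := abs_le h
    have h4 : ((h : ℝ) + 1 + ((ε h : SignType) : ℝ)) * ((g : ℝ) + h) ≤ (n + 1) * (2 * n) :=
      mul_le_mul (by linarith) (by linarith) (by linarith) (by linarith)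
    dsimp only
    nlinarith

/-- The ladder with the base line above can be realized. -/
theorem exists_ladder_neg (hn : 3 ≤ n) :
    ∃ p : Fin n → ℝ × ℝ, GeneralPosition p ∧ IsLadder (pointChirotope p) (-1) fun _ => 1 := by
  have hn' : (3 : ℝ) ≤ n := by exact_mod_cast hn
  have cast_lt : ∀ {h : ℕ}, h < n → (h : ℝ) + 1 ≤ n := fun h => by exact_mod_cast h
  -- The base line is horizontal at height `n`, above all levels. The twin slope `1 / (2 * n)` is
  -- below every chord slope, since `g + h < 2 * n`.
  refine exists_ladder (a := (-(n : ℝ) ^ 2, n)) (b := (4 * (n : ℝ) ^ 2, n))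
    (d := fun _ => (2 * (n : ℝ), 1)) hn (by decide) (fun _ => by decide) ?_ ?_ ?_ ?_ ?_ ?_
  · intro h _ hh
    have h2 := cast_lt hh
    apply sign_neg
    rw [show area (-(n : ℝ) ^ 2, (n : ℝ)) (4 * (n : ℝ) ^ 2, (n : ℝ)) (levelPoint h) =
      5 * (n : ℝ) ^ 2 * (h - n) by simp only [area, levelPoint]; ring]
    exact mul_neg_of_pos_of_neg (by positivity) (by linarith)
  · intro g h hg hgh hh
    have h0 : (1 : ℝ) ≤ g := by exact_mod_cast hg
    have h1 : (g : ℝ) < h := by exact_mod_cast hgh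
    have h2 := cast_lt hh
    rw [show area (-(n : ℝ) ^ 2, (n : ℝ)) (levelPoint g) (levelPoint h) =
      ((h : ℝ) - g) * ((n : ℝ) ^ 2 - g * h + n * (g + h)) by simp only [area, levelPoint]; ring]
    refine mul_pos (by linarith) ?_
    nlinarith
  · intro g h hg hgh hh
    have h0 : (1 : ℝ) ≤ g := by exact_mod_cast hg
    have h1 : (g : ℝ) < h := by exact_mod_cast hgh
    have h2 := cast_lt hh
    rw [show area (4 * (n : ℝ) ^ 2, (n : ℝ)) (levelPoint g) (levelPoint h) =
      ((h : ℝ) - g) * (-(4 * (n : ℝ) ^ 2) - g * h + n * (g + h)) by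
        simp only [area, levelPoint]; ring]
    refine mul_neg_of_pos_of_neg (by linarith) ?_
    nlinarith
  · intro h _ hh
    have h2 := cast_lt hh
    apply sign_pos
    simp only [vecDet, levelPoint, Prod.mk_sub_mk]
    nlinarith
  · intro h _ hh
    have h0 : (0 : ℝ) ≤ h := Nat.cast_nonneg h
    have h2 := cast_lt hh
    simp only [vecDet, levelPoint, Prod.mk_sub_mk]
    nlinarith
  · intro g h hg _ hh
    have h1 := cast_lt hg
    have h2 := cast_lt hh
    dsimp only
    linarith

end Realization

end RadialSystems

/-! ### The adversary argument -/

theorem mainTheorem6 :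
    ∃ c : ℝ, 0 < c ∧ ∃ N : ℕ, ∀ n : ℕ, N ≤ n →
      ∀ A : RadialSystems.Algorithm n, A.DeterminesCard →
        ∃ R : RadialSystems.RotationSystem n, RadialSystems.IsOrderTypeRadialSystem R ∧
          c * (n : ℝ) ≤ (A.numQueries R : ℝ) := by
  open RadialSystems in
  refine ⟨1 / 16, by norm_num, 16, fun n hn A hA => ?_⟩
  obtain ⟨p, hp, hlad⟩ := exists_ladder_pos (n := n) (by omega) (ε := fun _ => 1)
    (fun _ => by decide)
  obtain ⟨p', hp', hlad'⟩ := exists_ladder_neg (n := n) (by omega)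
  obtain ⟨R, hR⟩ := hp.exists_isRadialSystemOf
  have hcard := hlad.one_lt_ncard hlad' (by omega) hp.isAbstractChirotope hp'.isAbstractChirotope hR
  refine ⟨R, ⟨p, hp, hR⟩, ?_⟩
  obtain ⟨S, hS, hrun⟩ := A.exists_touched R
  by_contra hlt
  push Not at hlt
  have hq : 16 * A.numQueries R < n := by
    have : (16 * A.numQueries R : ℝ) < n := by linarith
    exact_mod_cast this
  -- Fewer than `n / 16` queries touch fewer than `n / 4` levels, while `n / 2 - 2` complete levels
  -- from 2 on are available. Level 0 holds the labels `0, 1`, and level 1 is the reference level of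
  -- the uniqueness proof.
  obtain ⟨m, hm, hmS⟩ : ∃ m ∈ Finset.Ico 2 (n / 2), m ∉ S := by
    refine Finset.exists_mem_notMem_of_card_lt_card ?_
    rw [Nat.card_Ico]
    omega
  rw [Finset.mem_Ico] at hm
  obtain ⟨q, hq', hladq⟩ := exists_ladder_pos (n := n) (by omega)
    (ε := fun l => if l = m then -1 else 1) (fun l => by split_ifs <;> decide)
  obtain ⟨R', hR'⟩ := hq'.exists_isRadialSystemOf
  have hcard' := hladq.ncard_le_one (by omega) hm.1 (by omega) hR'
  have hagree := hlad.agreeOff hladq (m := m) (fun l hl => (if_neg hl).symm)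
    (y := ⟨2 * m, by omega⟩) (z := ⟨2 * m + 1, by omega⟩) rfl rfl
  -- The outputs on `R` and `R'` coincide, although the counts are at least 2 and at most 1.
  have hsame := hrun R' m hmS fun Q hQ => Query.answer_eq (m := m) (by simp) (by simp; omega)
    hagree (by simp) hR hR' Q hQ
  rw [hA R ⟨p, hp, hR⟩, hA R' ⟨q, hq', hR'⟩] at hsame
  omega
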